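/- All Banach spaces are real. A normalized basic sequence $(x_i)_{i\ge1}$ in a Banach space $X$ generates the spreading model $(\tilde x_i)$ if there are $\varepsilon_n\downarrow 0$ such that for all $n$, all $a_1,\dots,a_n\in[-1,1]$ and all $n\le k_1<\dots<k_n$, $$(1+\varepsilon_n)^{-1}\Big\|\sum_{i=1}^n a_i\tilde x_i\Big\|\le\Big\|\sum_{i=1}^n a_i x_{k_i}\Big\|\le(1+\varepsilon_n)\Big\|\sum_{i=1}^n a_i\tilde x_i\Big\|.$$ For two spreading models write $(\tilde x_i)\le(\tilde y_i)$ if there is $C<\infty$ with $\|\sum a_i\tilde x_i\|\le C\|\sum a_i\tilde y_i\|$ for all finitely supported real $(a_i)$; they are equivalent if each dominates the other. Let $SP_w(X)$ be the set of equivalence classes of spreading models generated by normalized weakly null basic sequences in $X$, partially ordered by $\le$. **Theorem.** (1) Let $X$ be an infinite-dimensional Banach space such that $SP_w(X)$ is a countable chain (i.e. countable and totally ordered). Then there is a countable ordinal $\alpha$ such that $SP_w(X)$ is order-isomorphic to $\alpha$ with the reverse order. (2) Conversely, for every countable ordinal $\alpha\ge1$ there is a separable infinite-dimensional reflexive Banach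 space $X$ such that $SP_w(X)$ is order-isomorphic to $\alpha$ with the reverse order. Moreover, $X$ can be taken of the form $X=\big(\sum_{\beta<\alpha}\oplus\,\ell_{p_\beta}\big)_{\ell_2}$ with $\beta\mapsto p_\beta\in[2,3]$ strictly increasing. -/

import Mathlib

open Filter Topology

namespace SpreadingModels

/-- `(xᵢ)` is a basic sequence: a Schauder basis of its closed linear span. -/
def IsBasicSequence {X : Type*} [NormedAddCommGroup X] [NormedSpace ℝ X] (x : ℕ → X) : Prop :=
  ∃ b : SchauderBasis ℝ (Submodule.span ℝ (Set.range x)).topologicalClosure,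
    ∀ i, (b i : X) = x i

/-- `(xᵢ)` is weakly null. -/
def IsWeaklyNull {X : Type*} [NormedAddCommGroup X] [NormedSpace ℝ X] (x : ℕ → X) : Prop :=
  ∀ f : StrongDual ℝ X, Tendsto (fun i => f (x i)) atTop (𝓝 0)

/-- The normalized basic sequence `(xᵢ)` generates the spreading model `(x̃ᵢ)`, where the spreading
model is given by the norm `N` on `c₀₀ = (ℕ →₀ ℝ)` with `N a = ‖∑ aᵢ x̃ᵢ‖` (the `x̃ᵢ` are the unit
vectors in the completion of `(c₀₀, N)`; the inequalities force `N` to be a norm, and they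
determine it).  Sequences are indexed from `0` here, so `x (k i)` is the term usually numbered
`k i + 1`, and the requirement `n ≤ k₁ < ⋯ < kₙ` reads `n ≤ k i + 1`. -/
def GeneratesSpreadingModel {X : Type*} [NormedAddCommGroup X] [NormedSpace ℝ X]
    (x : ℕ → X) (N : Seminorm ℝ (ℕ →₀ ℝ)) : Prop :=
  (∀ i, ‖x i‖ = 1) ∧ IsBasicSequence x ∧
  ∃ ε : ℕ → ℝ, Antitone ε ∧ Tendsto ε atTop (𝓝 0) ∧
    ∀ (n : ℕ) (a : Fin n → ℝ), (∀ i, a i ∈ Set.Icc (-1 : ℝ) 1) →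
      ∀ k : Fin n → ℕ, StrictMono k → (∀ i, n ≤ k i + 1) →
        (1 + ε n)⁻¹ * N (∑ i : Fin n, Finsupp.single (i : ℕ) (a i)) ≤ ‖∑ i : Fin n, a i • x (k i)‖ ∧
        ‖∑ i : Fin n, a i • x (k i)‖ ≤ (1 + ε n) * N (∑ i : Fin n, Finsupp.single (i : ℕ) (a i))

/-- The spreading models of `X` generated by normalized weakly null basic sequences. -/
def WeakSpreadingModel (X : Type*) [NormedAddCommGroup X] [NormedSpace ℝ X] : Type :=
  {N : Seminorm ℝ (ℕ →₀ ℝ) // ∃ x : ℕ → X, IsWeaklyNull x ∧ GeneratesSpreadingModel x N}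

/-- `M ≤ N` when `N` `C`-dominates `M` for some finite constant `C`. -/
instance (X : Type*) [NormedAddCommGroup X] [NormedSpace ℝ X] :
    Preorder (WeakSpreadingModel X) where
  le M N := ∃ C : ℝ, ∀ a : ℕ →₀ ℝ, M.1 a ≤ C * N.1 a
  le_refl M := ⟨1, fun a => by simp⟩
  le_trans M N P := by
    rintro ⟨C, hC⟩ ⟨D, hD⟩
    refine ⟨|C| * D, fun a => ?_⟩
    calc M.1 a ≤ C * N.1 a := hC a
      _ ≤ |C| * N.1 a := mul_le_mul_of_nonneg_right (le_abs_self C) (apply_nonneg N.1 a)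
      _ ≤ |C| * (D * P.1 a) := mul_le_mul_of_nonneg_left (hD a) (abs_nonneg C)
      _ = |C| * D * P.1 a := (mul_assoc _ _ _).symm

/-- `SP_w(X)`: the equivalence classes (each dominates the other) of spreading models of `X`
generated by normalized weakly null basic sequences, partially ordered by domination. -/
abbrev SPw (X : Type*) [NormedAddCommGroup X] [NormedSpace ℝ X] : Type :=
  Antisymmetrization (WeakSpreadingModel X) (· ≤ ·)

/-- `X` is reflexive: the canonical map into the bidual is onto. -/
def IsReflexiveSpace (X : Type*) [NormedAddCommGroup X] [NormedSpace ℝ X] : Prop :=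
  Function.Surjective (NormedSpace.inclusionInDoubleDual ℝ X)

instance factOneLeExponent (q : Set.Icc (2 : ℝ) 3) : Fact (1 ≤ ENNReal.ofReal (q : ℝ)) :=
  ⟨ENNReal.one_le_ofReal.2 (one_le_two.trans q.2.1)⟩

/-- The `ℓ₂`-sum of the real sequence spaces `ℓ_{p β}`, `β ∈ ι`. -/
abbrev EllTwoSum {ι : Type*} (p : ι → Set.Icc (2 : ℝ) 3) : Type _ :=
  lp (fun β : ι => lp (fun _ : ℕ => ℝ) (ENNReal.ofReal (p β : ℝ))) 2

end SpreadingModels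

open SpreadingModels

/-! The basic tool is the iterated limit: if a normalized weakly null sequence generates a spreading
model `N`, then `N a` is the limit of `‖∑ a j • x (k j)‖` as the indices `k j` tend to infinity one
after the other, the last one innermost, along any free ultrafilter. Conversely, a normalized
family, indexed by any set and weakly null along an ultrafilter, contains a basic sequence
generating the spreading model given by its iterated limits (`exists_generatesSpreadingModel`).
Iterated limits of 1-Lipschitz convex functions are again 1-Lipschitz and convex, hence weakly lower
semicontinuous, so adding weakly null variables can only increase them.

For (1) it has to be shown that a countable `SPw X` has no strictly increasing sequence. Given
weakly null sequences `x n` with spreading models `N n` and small weights `c n > 0`, the vectors `∑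
c n • x n (k n)` with independent indices `k n` give a spreading model `u` that dominates every `N
n`, by lower semicontinuity, and is dominated by `∑ c n * N n`, by the triangle inequality
(`exists_weakSpreadingModel_weighted`). Now let the classes of the `N n` increase strictly. If `T`
bounds them all, it is not dominated by any finite sum of them, so there are vectors at which `T` is
arbitrarily large compared with such sums. Choosing the weights by diagonalization over an
enumeration of all classes makes `∑ c n * N n` much smaller than every such `T` at suitable vectors
(`exists_weights`). Thus `u` is an upper bound equivalent to none of the upper bounds in the
enumeration, which is absurd.

For (2) the exponents are chosen strictly increasing in `[2, 3]`, the least one being `2`. For a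
normalized weakly null sequence in the `ℓ₂`-sum let `c β` be the limit of the norms of its `β`-th
coordinates. If `∑ c β ^ 2 < 1`, part of the mass escapes through the outer sum and the spreading
model is equivalent to the `ℓ₂` basis, the upper estimate coming from `p β ≥ 2`. If the sum is `1`,
the spreading model is equivalent to the basis of `ℓ_{p β}` for the least `β` with `c β ≠ 0`. A
larger exponent gives a smaller norm, hence the reverse order. -/

namespace SpreadingModels

/-! ### Fubini powers of an ultrafilter -/

/-- The `n`-fold Fubini power of an ultrafilter: the first coordinate is the outermost one. -/
noncomputable def iterPow {I : Type*} (U : Ultrafilter I) : (n : ℕ) → Ultrafilter (Fin n → I)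
  | 0 => pure Fin.elim0
  | n + 1 => U.bind fun i => (iterPow U n).map (Fin.cons (α := fun _ => I) i)

section iterPow

variable {I : Type*} {U : Ultrafilter I}

theorem eventually_iterPow_succ {n : ℕ} {P : (Fin (n + 1) → I) → Prop} :
    (∀ᶠ k in (iterPow U (n + 1) : Filter (Fin (n + 1) → I)), P k) ↔
      ∀ᶠ i in (U : Filter I), ∀ᶠ k in (iterPow U n : Filter (Fin n → I)),
        P (Fin.cons (α := fun _ => I) i k) :=
  Iff.rfl

/-- The inner limits need only exist pointwise in the outer variable: membership in a Fubini power
lets the inner set depend on the outer index. -/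
theorem tendsto_iterPow_succ {n : ℕ} {f : (Fin (n + 1) → I) → ℝ} {g : I → ℝ} {L : ℝ}
    (hf : ∀ i, Tendsto (fun k => f (Fin.cons (α := fun _ => I) i k)) (iterPow U n) (𝓝 (g i)))
    (hg : Tendsto g U (𝓝 L)) : Tendsto f (iterPow U (n + 1)) (𝓝 L) := by
  rw [Metric.tendsto_nhds] at hg ⊢
  intro ε hε
  rw [eventually_iterPow_succ]
  filter_upwards [hg (ε / 2) (half_pos hε)] with i hi
  filter_upwards [Metric.tendsto_nhds.1 (hf i) (ε / 2) (half_pos hε)] with k hk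
  exact (dist_triangle _ _ _).trans_lt (by linarith)

theorem eventually_iterPow_eval {n : ℕ} (j : Fin n) {P : I → Prop}
    (h : ∀ᶠ i in (U : Filter I), P i) :
    ∀ᶠ k in (iterPow U n : Filter (Fin n → I)), P (k j) := by
  induction n with
  | zero => exact j.elim0
  | succ n ih =>
    rw [eventually_iterPow_succ]
    refine Fin.cases ?_ (fun j => ?_) j
    · filter_upwards [h] with i hi
      exact Eventually.of_forall fun k => by simpa using hi
    · refine Eventually.of_forall fun i => ?_
      simpa using ih j

theorem tendsto_iterPow_eval {n : ℕ} (j : Fin n) :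
    Tendsto (fun k : Fin n → I => k j) (iterPow U n) U :=
  fun _ hs => eventually_iterPow_eval j hs

/-- Each later index is chosen after the earlier ones are fixed. With `<` as the relation this makes
almost all tuples strictly increasing. -/
theorem eventually_iterPow_pairwise {n : ℕ} {R : I → I → Prop}
    (h : ∀ i, ∀ᶠ i' in (U : Filter I), R i i') :
    ∀ᶠ k in (iterPow U n : Filter (Fin n → I)), ∀ s t : Fin n, s < t → R (k s) (k t) := by
  induction n with
  | zero => exact Eventually.of_forall fun k s => s.elim0
  | succ n ih =>
    rw [eventually_iterPow_succ]
    refine Eventually.of_forall fun i => ?_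
    have h1 : ∀ᶠ k in (iterPow U n : Filter (Fin n → I)), ∀ j, R i (k j) :=
      eventually_all.2 fun j => eventually_iterPow_eval j (h i)
    filter_upwards [ih, h1] with k hk hk1 s t
    refine Fin.cases (fun hst => ?_) (fun t => ?_) t
    · exact absurd hst (Fin.not_lt_zero _)
    · refine Fin.cases (fun _ => by simpa using hk1 t) (fun s hst => ?_) s
      simpa using hk s t (by simpa using hst)

end iterPow

/-! ### Iterated limits -/

theorem exists_tendsto_of_bounded {I : Type*} (U : Ultrafilter I) {f : I → ℝ} {C : ℝ}
    (hf : ∀ i, |f i| ≤ C) : ∃ L, Tendsto f U (𝓝 L) := by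
  obtain ⟨L, -, hL⟩ := (isCompact_Icc (a := -C) (b := C)).ultrafilter_le_nhds (U.map f)
    (by
      rw [Ultrafilter.coe_map, le_principal_iff, mem_map]
      exact Eventually.of_forall (f := (U : Filter I)) fun i => abs_le.1 (hf i))
  exact ⟨L, hL⟩

section iterLim

variable {I X : Type*} [NormedAddCommGroup X] {U : Ultrafilter I}

/-- The iterated limit of `F (v + ∑ z j (k j))` as `k 0 → U`, ..., `k (n - 1) → U`, the innermost
limit being that over the last index. -/
noncomputable def iterLim (U : Ultrafilter I) (F : X → ℝ) {n : ℕ} (z : Fin n → I → X) (v : X) : ℝ :=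
  limUnder (iterPow U n : Filter (Fin n → I)) fun k => F (v + ∑ j, z j (k j))

theorem tendsto_iterLim {F : X → ℝ} (hF : LipschitzWith 1 F) {n : ℕ} {z : Fin n → I → X}
    (hz : ∀ j, ∃ C, ∀ i, ‖z j i‖ ≤ C) (v : X) :
    Tendsto (fun k : Fin n → I => F (v + ∑ j, z j (k j))) (iterPow U n) (𝓝 (iterLim U F z v)) := by
  choose C hC using hz
  refine tendsto_nhds_limUnder (exists_tendsto_of_bounded _ (C := |F v| + ∑ j, C j) fun k => ?_)
  have h1 : |F (v + ∑ j, z j (k j)) - F v| ≤ ∑ j, C j := by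
    have := hF.dist_le_mul (v + ∑ j, z j (k j)) v
    rw [Real.dist_eq, dist_eq_norm, add_sub_cancel_left, NNReal.coe_one, one_mul] at this
    exact this.trans ((norm_sum_le _ _).trans (Finset.sum_le_sum fun j _ => hC j _))
  have h2 := abs_add_le (F v) (F (v + ∑ j, z j (k j)) - F v)
  rw [add_sub_cancel] at h2
  linarith

/-- Peels off the outermost variable, so that statements about iterated limits reduce by induction
to statements about one limit. -/
theorem tendsto_iterLim_succ {F : X → ℝ} (hF : LipschitzWith 1 F) {n : ℕ}
    {z : Fin (n + 1) → I → X} (hz : ∀ j, ∃ C, ∀ i, ‖z j i‖ ≤ C) (v : X) :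
    Tendsto (fun i => iterLim U F (fun j => z j.succ) (v + z 0 i)) U (𝓝 (iterLim U F z v)) := by
  have h1 : ∀ w, Tendsto (fun k : Fin n → I => F (w + ∑ j : Fin n, z j.succ (k j))) (iterPow U n)
      (𝓝 (iterLim U F (fun j => z j.succ) w)) := fun w => tendsto_iterLim hF (fun j => hz j.succ) w
  choose C hC using hz
  obtain ⟨L, hL⟩ := exists_tendsto_of_bounded U (C := |F v| + ∑ j, C j)
    (f := fun i => iterLim U F (fun j => z j.succ) (v + z 0 i)) (fun i => by
      refine le_of_tendsto (h1 (v + z 0 i)).abs (Eventually.of_forall fun k => ?_)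
      have h1 : |F (v + z 0 i + ∑ j : Fin n, z j.succ (k j)) - F v| ≤ ∑ j, C j := by
        have := hF.dist_le_mul (v + z 0 i + ∑ j : Fin n, z j.succ (k j)) v
        rw [Real.dist_eq, dist_eq_norm, add_assoc, add_sub_cancel_left, NNReal.coe_one,
          one_mul, ← add_assoc] at this
        refine this.trans ((norm_add_le _ _).trans ?_)
        rw [Fin.sum_univ_succ]
        exact add_le_add (hC 0 i) ((norm_sum_le _ _).trans (Finset.sum_le_sum fun j _ => hC _ _))
      have h2 := abs_add_le (F v) (F (v + z 0 i + ∑ j : Fin n, z j.succ (k j)) - F v)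
      rw [add_sub_cancel] at h2
      linarith)
  have h2 : Tendsto (fun k : Fin (n + 1) → I => F (v + ∑ j, z j (k j))) (iterPow U (n + 1)) (𝓝 L) := by
    refine tendsto_iterPow_succ (fun i => ?_) hL
    simpa [Fin.sum_univ_succ, add_assoc] using h1 (v + z 0 i)
  rwa [tendsto_nhds_unique (tendsto_iterLim hF (fun j => ⟨C j, hC j⟩) v) h2]

theorem iterLim_zero {F : X → ℝ} (z : Fin 0 → I → X) (v : X) : iterLim U F z v = F v := by
  simp only [iterLim, Finset.univ_eq_empty, Finset.sum_empty, add_zero]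
  exact tendsto_const_nhds.limUnder_eq

theorem abs_iterLim_sub_le {F : X → ℝ} (hF : LipschitzWith 1 F) {n : ℕ} {z z' : Fin n → I → X}
    (hz : ∀ j, ∃ C, ∀ i, ‖z j i‖ ≤ C) (hz' : ∀ j, ∃ C, ∀ i, ‖z' j i‖ ≤ C) {B : Fin n → ℝ}
    (hB : ∀ j i, ‖z j i - z' j i‖ ≤ B j) (v v' : X) :
    |iterLim U F z v - iterLim U F z' v'| ≤ ‖v - v'‖ + ∑ j, B j := by
  refine le_of_tendsto ((tendsto_iterLim hF hz v).sub (tendsto_iterLim hF hz' v')).abs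
    (Eventually.of_forall fun k => ?_)
  have := hF.dist_le_mul (v + ∑ j, z j (k j)) (v' + ∑ j, z' j (k j))
  rw [Real.dist_eq, dist_eq_norm, NNReal.coe_one, one_mul, add_sub_add_comm,
    ← Finset.sum_sub_distrib] at this
  refine this.trans ((norm_add_le _ _).trans ?_)
  gcongr
  exact (norm_sum_le _ _).trans (Finset.sum_le_sum fun j _ => hB j _)

theorem lipschitzWith_iterLim {F : X → ℝ} (hF : LipschitzWith 1 F) {n : ℕ} {z : Fin n → I → X}
    (hz : ∀ j, ∃ C, ∀ i, ‖z j i‖ ≤ C) : LipschitzWith 1 (iterLim U F z) := by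
  refine LipschitzWith.of_dist_le_mul fun v v' => ?_
  simpa [Real.dist_eq, dist_eq_norm] using
    abs_iterLim_sub_le (U := U) hF hz hz (B := 0) (by simp) v v'

/-- Asymptotically equal sequences have the same iterated limits. -/
theorem iterLim_congr {F : X → ℝ} (hF : LipschitzWith 1 F) {n : ℕ} {z z' : Fin n → I → X}
    (hz : ∀ j, ∃ C, ∀ i, ‖z j i‖ ≤ C) (hz' : ∀ j, ∃ C, ∀ i, ‖z' j i‖ ≤ C)
    (h : ∀ j, Tendsto (fun i => z j i - z' j i) U (𝓝 0)) (v : X) :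
    iterLim U F z v = iterLim U F z' v := by
  have h1 : Tendsto (fun k : Fin n → I => ∑ j, z j (k j) - ∑ j, z' j (k j)) (iterPow U n)
      (𝓝 0) := by
    have := tendsto_finsetSum Finset.univ fun j (_ : j ∈ (Finset.univ : Finset (Fin n))) =>
      (h j).comp (tendsto_iterPow_eval j)
    simpa [Finset.sum_sub_distrib] using this
  have h2 := (tendsto_iterLim (U := U) hF hz v).sub (tendsto_iterLim hF hz' v)
  have h3 : Tendsto (fun k : Fin n → I => F (v + ∑ j, z j (k j)) - F (v + ∑ j, z' j (k j)))
      (iterPow U n) (𝓝 0) := by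
    refine squeeze_zero_norm (fun k => ?_) (by simpa using h1.norm)
    have := hF.dist_le_mul (v + ∑ j, z j (k j)) (v + ∑ j, z' j (k j))
    rwa [dist_eq_norm, dist_eq_norm, NNReal.coe_one, one_mul, add_sub_add_left_eq_sub] at this
  exact sub_eq_zero.1 (tendsto_nhds_unique h2 h3)

theorem tendsto_iterLim_norm_zero {n : ℕ} {z : Fin n → I → X} (hz : ∀ j, ∃ C, ∀ i, ‖z j i‖ ≤ C) :
    Tendsto (fun k : Fin n → I => ‖∑ j, z j (k j)‖) (iterPow U n) (𝓝 (iterLim U norm z 0)) := by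
  simpa using tendsto_iterLim (U := U) lipschitzWith_one_norm hz 0

variable [NormedSpace ℝ X]

/-- Together with `lipschitzWith_iterLim`, this makes a partial iterated limit an admissible
function for the next weak lower semicontinuity argument. -/
theorem convexOn_iterLim {F : X → ℝ} (hF : LipschitzWith 1 F) (hc : ConvexOn ℝ Set.univ F) {n : ℕ}
    {z : Fin n → I → X} (hz : ∀ j, ∃ C, ∀ i, ‖z j i‖ ≤ C) :
    ConvexOn ℝ Set.univ (iterLim U F z) := by
  refine ⟨convex_univ, fun v _ w _ a b ha hb hab => ?_⟩
  refine le_of_tendsto_of_tendsto (tendsto_iterLim hF hz _)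
    (((tendsto_iterLim hF hz v).const_smul a).add ((tendsto_iterLim hF hz w).const_smul b))
    (Eventually.of_forall fun k => ?_)
  have := hc.2 (Set.mem_univ (v + ∑ j, z j (k j))) (Set.mem_univ (w + ∑ j, z j (k j))) ha hb hab
  refine le_trans (le_of_eq ?_) this
  rw [smul_add, smul_add, add_add_add_comm, ← add_smul, hab, one_smul]

/-- Convex continuous functions are weakly lower semicontinuous. -/
theorem le_of_tendsto_of_convexOn {F : X → ℝ} (hF : Continuous F) (hc : ConvexOn ℝ Set.univ F)
    {z : I → X} (hz : ∀ f : StrongDual ℝ X, Tendsto (fun i => f (z i)) U (𝓝 0)) {v : X} {L : ℝ}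
    (h : Tendsto (fun i => F (v + z i)) U (𝓝 L)) : F v ≤ L := by
  refine le_of_forall_lt fun a ha => ?_
  obtain ⟨b, hab, hb⟩ := exists_between ha
  -- By Hahn–Banach there is a continuous affine minorant with value `b` at `v`; its values converge
  -- along the weakly null family.
  obtain ⟨l, c, hlc, hv⟩ := ConvexOn.exists_affine_le_of_lt (𝕜 := ℝ) (Set.mem_univ v) hb isClosed_univ
    (hF.lowerSemicontinuous.lowerSemicontinuousOn _) hc
  have h1 : ∀ w, l w + c ≤ F w := fun w => hlc ⟨w, Set.mem_univ w⟩
  refine hab.trans_le ?_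
  have h2 : Tendsto (fun i => l (v + z i) + c) U (𝓝 (l v + 0 + c)) := by
    simpa only [map_add] using ((hz l).const_add (l v)).add_const c
  rw [← hv]
  simpa using le_of_tendsto_of_tendsto h2 h (Eventually.of_forall fun i => h1 _)

/-- Weak lower semicontinuity, applied to one variable at a time. -/
theorem le_iterLim {F : X → ℝ} (hF : LipschitzWith 1 F) (hc : ConvexOn ℝ Set.univ F) {n : ℕ}
    {z : Fin n → I → X} (hz : ∀ j, ∃ C, ∀ i, ‖z j i‖ ≤ C)
    (hw : ∀ j, ∀ f : StrongDual ℝ X, Tendsto (fun i => f (z j i)) U (𝓝 0)) (v : X) :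
    F v ≤ iterLim U F z v := by
  induction n generalizing v with
  | zero => rw [iterLim_zero]
  | succ n ih =>
    obtain ⟨C, hC⟩ := hz 0
    obtain ⟨L, hL⟩ := exists_tendsto_of_bounded U (f := fun i => F (v + z 0 i)) (C := |F v| + C)
      (fun i => by
        have := hF.dist_le_mul (v + z 0 i) v
        rw [Real.dist_eq, dist_eq_norm, add_sub_cancel_left, NNReal.coe_one, one_mul] at this
        have h2 := abs_add_le (F v) (F (v + z 0 i) - F v)
        rw [add_sub_cancel] at h2
        linarith [hC i])
    exact (le_of_tendsto_of_convexOn hF.continuous hc (hw 0) hL).trans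
      (le_of_tendsto_of_tendsto hL (tendsto_iterLim_succ hF hz v)
        (Eventually.of_forall fun i => ih (fun j => hz j.succ) (fun j => hw j.succ) _))

/-- An iterated limit along several weakly null sequences dominates the limit along each one. -/
theorem le_iterLim_of_tendsto {F : X → ℝ} (hF : LipschitzWith 1 F) (hc : ConvexOn ℝ Set.univ F)
    {n : ℕ} {z : Fin n → I → X} (hz : ∀ j, ∃ C, ∀ i, ‖z j i‖ ≤ C)
    (hw : ∀ j, ∀ f : StrongDual ℝ X, Tendsto (fun i => f (z j i)) U (𝓝 0)) (m : Fin n) {v : X}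
    {L : ℝ} (hL : Tendsto (fun i => F (v + z m i)) U (𝓝 L)) : L ≤ iterLim U F z v := by
  induction n with
  | zero => exact m.elim0
  | succ n ih =>
    revert hL
    refine Fin.cases (fun hL => ?_) (fun m hL => ?_) m
    · exact le_of_tendsto_of_tendsto hL (tendsto_iterLim_succ hF hz v)
        (Eventually.of_forall fun i =>
          le_iterLim hF hc (fun j => hz j.succ) (fun j => hw j.succ) _)
    -- The iterated limit over the later indices is a continuous convex function of the base vector,
    -- so omitting the outermost weakly null variable does not increase it.
    · exact (ih (fun j => hz j.succ) (fun j => hw j.succ) m hL).trans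
        (le_of_tendsto_of_convexOn (lipschitzWith_iterLim hF fun j => hz j.succ).continuous
          (convexOn_iterLim hF hc fun j => hz j.succ) (hw 0) (tendsto_iterLim_succ hF hz v))

end iterLim

/-! ### Spreading models as iterated limits -/

section spreading

variable {X : Type*} [NormedAddCommGroup X] [NormedSpace ℝ X]

theorem exists_strictMono_extension {n : ℕ} {k : Fin n → ℕ} (hk : StrictMono k) {m : ℕ}
    (hm : ∀ i, m ≤ k i) :
    ∃ l : ℕ → ℕ, StrictMono l ∧ (∀ i : Fin n, l i = k i) ∧ ∀ i, m ≤ l i := by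
  set K := m + ∑ i, k i + 1 with hK
  have hkK : ∀ i, k i < K := fun i => by
    have := Finset.single_le_sum (f := k) (fun _ _ => Nat.zero_le _) (Finset.mem_univ i)
    omega
  refine ⟨fun i => if h : i < n then k ⟨i, h⟩ else K + i, fun i j hij => ?_, fun i => by simp,
    fun i => ?_⟩
  · dsimp only
    split_ifs with h1 h2 h2
    · exact hk (by simpa using hij)
    · have := hkK ⟨i, h1⟩
      omega
    · omega
    · omega
  · dsimp only
    split_ifs with h1
    · exact hm _
    · omega

theorem GeneratesSpreadingModel.tendsto_of_mem_Icc {x : ℕ → X} {N : Seminorm ℝ (ℕ →₀ ℝ)}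
    (h : GeneratesSpreadingModel x N) {U : Ultrafilter ℕ} (hU : (U : Filter ℕ) ≤ atTop) {n : ℕ}
    {a : Fin n → ℝ} (ha : ∀ i, a i ∈ Set.Icc (-1 : ℝ) 1) :
    Tendsto (fun k : Fin n → ℕ => ‖∑ i, a i • x (k i)‖) (iterPow U n)
      (𝓝 (N (∑ i : Fin n, Finsupp.single (i : ℕ) (a i)))) := by
  obtain ⟨-, -, ε, -, hε, hN⟩ := h
  -- The definition ties the error to the length of the combination. Padding with zero coefficients
  -- to length `m` replaces `ε n` by `ε m`, which is as small as desired.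
  have key : ∀ m, n ≤ m → ∀ᶠ k : Fin n → ℕ in iterPow U n,
      (1 + ε m)⁻¹ * N (∑ i : Fin n, Finsupp.single (i : ℕ) (a i)) ≤ ‖∑ i, a i • x (k i)‖ ∧
      ‖∑ i, a i • x (k i)‖ ≤ (1 + ε m) * N (∑ i : Fin n, Finsupp.single (i : ℕ) (a i)) := by
    intro m hm
    have h1 : ∀ᶠ k : Fin n → ℕ in iterPow U n, ∀ s t : Fin n, s < t → k s < k t :=
      eventually_iterPow_pairwise fun i => hU (eventually_gt_atTop i)
    have h2 : ∀ᶠ k : Fin n → ℕ in iterPow U n, ∀ s : Fin n, m ≤ k s :=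
      eventually_all.2 fun s => eventually_iterPow_eval s (hU (eventually_ge_atTop m))
    filter_upwards [h1, h2] with k hk1 hk2
    obtain ⟨l, hl, hlk, hml⟩ := exists_strictMono_extension (fun s t hst => hk1 s t hst) hk2
    set b : ℕ → ℝ := fun i => if h : i < n then a ⟨i, h⟩ else 0 with hb
    have hbn : ∀ i : Fin n, b i = a i := fun i => by simp [hb]
    have hb0 : ∀ i, i ∈ Finset.range m → i ∉ Finset.range n → b i = 0 := fun i _ hi => by
      simp only [Finset.mem_range] at hi
      simp [hb, hi]
    have := hN m (fun i => b i) (fun i => ?_) (fun i => l i) (fun i j hij => hl hij)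
      (fun i => (hml i).trans (Nat.le_succ _))
    · have e1 : ∑ i : Fin m, Finsupp.single (i : ℕ) (b i)
          = ∑ i : Fin n, Finsupp.single (i : ℕ) (a i) := by
        rw [Fin.sum_univ_eq_sum_range (fun i => Finsupp.single i (b i)) m]
        rw [← Finset.sum_subset (Finset.range_mono hm) (fun i hi hi' => by simp [hb0 i hi hi'])]
        rw [← Fin.sum_univ_eq_sum_range (fun i => Finsupp.single i (b i)) n]
        simp [hbn]
      have e2 : ∑ i : Fin m, b i • x (l i) = ∑ i : Fin n, a i • x (k i) := by
        rw [Fin.sum_univ_eq_sum_range (fun i => b i • x (l i)) m]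
        rw [← Finset.sum_subset (Finset.range_mono hm) (fun i hi hi' => by simp [hb0 i hi hi'])]
        rw [← Fin.sum_univ_eq_sum_range (fun i => b i • x (l i)) n]
        simp [hbn, hlk]
      rwa [e1, e2] at this
    · by_cases hi : (i : ℕ) < n
      · simpa [hb, hi] using ha ⟨i, hi⟩
      · simp [hb, hi]
  set c := N (∑ i : Fin n, Finsupp.single (i : ℕ) (a i)) with hc
  have l1 : Tendsto (fun m => (1 + ε m)⁻¹ * c) atTop (𝓝 c) := by
    simpa using ((hε.const_add 1).inv₀ (by norm_num)).mul_const c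
  have l2 : Tendsto (fun m => (1 + ε m) * c) atTop (𝓝 c) := by
    simpa using (hε.const_add 1).mul_const c
  refine tendsto_order.2 ⟨fun b hb => ?_, fun b hb => ?_⟩
  · obtain ⟨m, hm, hmn⟩ := (((tendsto_order.1 l1).1 b hb).and (eventually_ge_atTop n)).exists
    filter_upwards [key m hmn] with k hk
    exact hm.trans_le hk.1
  · obtain ⟨m, hm, hmn⟩ := (((tendsto_order.1 l2).2 b hb).and (eventually_ge_atTop n)).exists
    filter_upwards [key m hmn] with k hk
    exact hk.2.trans_lt hm

theorem sum_single_smul {n : ℕ} (c : ℝ) (a : Fin n → ℝ) :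
    ∑ i : Fin n, Finsupp.single (i : ℕ) (c * a i)
      = c • ∑ i : Fin n, Finsupp.single (i : ℕ) (a i) := by
  simp [Finset.smul_sum]

/-- Every coefficient vector is a nonnegative multiple of one in the unit cube. -/
theorem exists_eq_mul_mem_Icc {n : ℕ} (a : Fin n → ℝ) :
    ∃ (c : ℝ) (b : Fin n → ℝ), 0 ≤ c ∧ (∀ i, b i ∈ Set.Icc (-1 : ℝ) 1) ∧ a = fun i => c * b i := by
  refine ⟨1 + ∑ i, |a i|, fun i => a i / (1 + ∑ i, |a i|), by positivity, fun i => ?_, ?_⟩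
  · have h1 := Finset.single_le_sum (f := fun i => |a i|) (fun _ _ => abs_nonneg _)
      (Finset.mem_univ i)
    have h2 : 0 < 1 + ∑ i, |a i| := by positivity
    rw [Set.mem_Icc, ← abs_le, abs_div, abs_of_pos h2, div_le_one h2]
    linarith
  · have h2 : 0 < 1 + ∑ i, |a i| := by positivity
    ext i
    field_simp

theorem GeneratesSpreadingModel.tendsto {x : ℕ → X} {N : Seminorm ℝ (ℕ →₀ ℝ)}
    (h : GeneratesSpreadingModel x N) {U : Ultrafilter ℕ} (hU : (U : Filter ℕ) ≤ atTop) {n : ℕ}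
    (a : Fin n → ℝ) :
    Tendsto (fun k : Fin n → ℕ => ‖∑ i, a i • x (k i)‖) (iterPow U n)
      (𝓝 (N (∑ i : Fin n, Finsupp.single (i : ℕ) (a i)))) := by
  obtain ⟨c, b, hc, hb, rfl⟩ := exists_eq_mul_mem_Icc a
  have := (h.tendsto_of_mem_Icc hU hb).const_mul c
  simp only [mul_smul, ← Finset.smul_sum, norm_smul, sum_single_smul, map_smul_eq_mul,
    Real.norm_of_nonneg hc]
  exact this

/-- The left-hand side does not involve `U`, so all free ultrafilters on the indices give the same
iterated limits. -/
theorem GeneratesSpreadingModel.eq_iterLim {x : ℕ → X} {N : Seminorm ℝ (ℕ →₀ ℝ)}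
    (h : GeneratesSpreadingModel x N) {U : Ultrafilter ℕ} (hU : (U : Filter ℕ) ≤ atTop) {n : ℕ}
    (a : Fin n → ℝ) :
    N (∑ i : Fin n, Finsupp.single (i : ℕ) (a i)) = iterLim U norm (fun j i => a j • x i) 0 :=
  tendsto_nhds_unique (h.tendsto hU a)
    (tendsto_iterLim_norm_zero fun j => ⟨|a j|, fun i => by simp [norm_smul, h.1]⟩)

theorem exists_eq_sum_single (f : ℕ →₀ ℝ) :
    ∃ (n : ℕ) (a : Fin n → ℝ), f = ∑ i : Fin n, Finsupp.single (i : ℕ) (a i) := by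
  obtain ⟨n, hn⟩ := f.support.exists_nat_subset_range
  refine ⟨n, fun i => f i, ?_⟩
  rw [Fin.sum_univ_eq_sum_range (fun i => Finsupp.single i (f i)) n]
  conv_lhs => rw [← f.sum_single]
  exact Finset.sum_subset hn fun i _ hi => by simp [Finsupp.notMem_support_iff.1 hi]

end spreading

/-! ### Grünblum's criterion -/

section Grunblum

variable {X : Type*} [NormedAddCommGroup X] [NormedSpace ℝ X] {x : ℕ → X} {C : ℝ}

theorem linearIndependent_of_norm_partial_sum_le (hx : ∀ i, x i ≠ 0)
    (h : ∀ (b : ℕ → ℝ) (m n : ℕ), m ≤ n →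
      ‖∑ i ∈ Finset.range m, b i • x i‖ ≤ C * ‖∑ i ∈ Finset.range n, b i • x i‖) :
    LinearIndependent ℝ x := by
  rw [linearIndependent_iff']
  intro s g hg i hi
  classical
  obtain ⟨n, hn⟩ := s.exists_nat_subset_range
  set b : ℕ → ℝ := fun i => if i ∈ s then g i else 0 with hb
  have h0 : ∑ i ∈ Finset.range n, b i • x i = 0 := by
    rw [← hg, ← Finset.sum_subset hn fun i _ hi => by simp [hb, hi]]
    exact Finset.sum_congr rfl fun i hi => by simp [hb, hi]
  have h1 : ∀ m ≤ n, ∑ i ∈ Finset.range m, b i • x i = 0 := fun m hm => by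
    have := h b m n hm
    rw [h0, norm_zero, mul_zero] at this
    exact norm_le_zero_iff.1 this
  have hin : i < n := Finset.mem_range.1 (hn hi)
  have h2 := h1 (i + 1) hin
  rw [Finset.sum_range_succ, h1 i hin.le, zero_add] at h2
  simpa [hb, hi, hx i] using h2

theorem mem_span_range_iff_exists_sum {v : X} :
    v ∈ Submodule.span ℝ (Set.range x) ↔
      ∃ (b : ℕ → ℝ) (n : ℕ), (∀ i, n ≤ i → b i = 0) ∧ v = ∑ i ∈ Finset.range n, b i • x i := by
  constructor
  · intro hv
    obtain ⟨c, rfl⟩ := (Finsupp.mem_span_range_iff_exists_finsupp).1 hv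
    obtain ⟨n, hn⟩ := c.support.exists_nat_subset_range
    refine ⟨c, n, fun i hi => ?_, ?_⟩
    · by_contra hne
      have := hn (Finsupp.mem_support_iff.2 hne)
      rw [Finset.mem_range] at this
      omega
    · exact Finset.sum_subset hn fun i _ hi => by simp [Finsupp.notMem_support_iff.1 hi]
  · rintro ⟨b, n, -, rfl⟩
    exact Submodule.sum_mem _ fun i _ =>
      Submodule.smul_mem _ _ (Submodule.subset_span ⟨i, rfl⟩)

/-- A term `b i • x i` is the difference of two consecutive partial sums, so the coordinate
functionals are bounded on the span; Hahn–Banach extends them. -/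
theorem exists_biorthogonal_of_norm_partial_sum_le (hx : ∀ i, x i ≠ 0)
    (h : ∀ (b : ℕ → ℝ) (m n : ℕ), m ≤ n →
      ‖∑ i ∈ Finset.range m, b i • x i‖ ≤ C * ‖∑ i ∈ Finset.range n, b i • x i‖) :
    ∃ f : ℕ → StrongDual ℝ X, ∀ i j, f i (x j) = if i = j then 1 else 0 := by
  have hli := linearIndependent_of_norm_partial_sum_le hx h
  have key : ∀ i, ∃ f : StrongDual ℝ X, ∀ j, f (x j) = if i = j then 1 else 0 := by
    intro i
    let B := Module.Basis.span hli
    have hB : ∀ j, B j = ⟨x j, Submodule.subset_span ⟨j, rfl⟩⟩ := fun j =>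
      Module.Basis.span_apply hli j
    have hbound : ∀ v, ‖B.coord i v‖ ≤ 2 * C / ‖x i‖ * ‖v‖ := by
      intro v
      obtain ⟨b, n, hbn, hb⟩ := mem_span_range_iff_exists_sum.1 v.2
      have hv : v = ∑ j ∈ Finset.range n, b j • B j := by
        apply Subtype.ext
        rw [hb]
        simp [hB]
      have hcoord : B.coord i v = b i := by
        rw [hv, map_sum]
        by_cases hi : i < n
        · simp [Finsupp.single_apply, hi]
        · simp [Finsupp.single_apply, hi, hbn i (not_lt.1 hi)]
      rw [hcoord]
      have hn : ∀ m, ‖∑ j ∈ Finset.range m, b j • x j‖ ≤ C * ‖v‖ := fun m => by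
        have h1 := h b m (max m n) (le_max_left _ _)
        rw [← Finset.sum_subset (Finset.range_mono (le_max_right m n)) fun j _ hj => by
          rw [hbn j (by simpa using hj), zero_smul], ← hb] at h1
        exact h1
      have h2 : ‖b i • x i‖ ≤ 2 * C * ‖v‖ := by
        have : b i • x i
            = ∑ j ∈ Finset.range (i + 1), b j • x j - ∑ j ∈ Finset.range i, b j • x j := by
          rw [Finset.sum_range_succ, add_sub_cancel_left]
        rw [this]
        have := norm_sub_le (∑ j ∈ Finset.range (i + 1), b j • x j)
          (∑ j ∈ Finset.range i, b j • x j)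
        linarith [hn (i + 1), hn i]
      rw [norm_smul] at h2
      have hpos : 0 < ‖x i‖ := norm_pos_iff.2 (hx i)
      rw [div_mul_eq_mul_div, le_div_iff₀ hpos]
      exact h2
    obtain ⟨g, hg, -⟩ := exists_extension_norm_eq (Submodule.span ℝ (Set.range x))
      ((B.coord i).mkContinuous _ hbound)
    refine ⟨g, fun j => ?_⟩
    have := hg ⟨x j, Submodule.subset_span ⟨j, rfl⟩⟩
    rw [this, ← hB]
    simp [Finsupp.single_apply, eq_comm]
  choose f hf using key
  exact ⟨f, hf⟩

/-- Grünblum's criterion. -/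
theorem isBasicSequence_of_norm_partial_sum_le (hx : ∀ i, x i ≠ 0)
    (h : ∀ (b : ℕ → ℝ) (m n : ℕ), m ≤ n →
      ‖∑ i ∈ Finset.range m, b i • x i‖ ≤ C * ‖∑ i ∈ Finset.range n, b i • x i‖) :
    IsBasicSequence x := by
  obtain ⟨f, hf⟩ := exists_biorthogonal_of_norm_partial_sum_le hx h
  set S := Submodule.span ℝ (Set.range x) with hS
  let T : ℕ → X →L[ℝ] X := fun n => ∑ i ∈ Finset.range n, (f i).smulRight (x i)
  have hT : ∀ n v, T n v = ∑ i ∈ Finset.range n, f i v • x i := fun n v => by simp [T]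
  have hfb : ∀ (b : ℕ → ℝ) (n i : ℕ), (∀ i, n ≤ i → b i = 0) →
      f i (∑ j ∈ Finset.range n, b j • x j) = b i := fun b n i hb => by
    by_cases hi : i < n
    · simp [hf, hi]
    · simp [hf, hi, hb i (not_lt.1 hi)]
  have hC : 0 ≤ C := by
    have h1 := h (fun _ => 1) 1 1 le_rfl
    have h2 : 0 < ‖x 0‖ := norm_pos_iff.2 (hx 0)
    simp only [Finset.range_one, Finset.sum_singleton, one_smul] at h1
    by_contra hneg
    nlinarith
  have hTS : ∀ v ∈ S, (∀ n, ‖T n v‖ ≤ C * ‖v‖) ∧ Tendsto (fun n => T n v) atTop (𝓝 v) := by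
    intro v hv
    obtain ⟨b, n, hbn, rfl⟩ := mem_span_range_iff_exists_sum.1 hv
    have e1 : ∀ m, n ≤ m → ∑ j ∈ Finset.range m, b j • x j = ∑ j ∈ Finset.range n, b j • x j :=
      fun m hm => (Finset.sum_subset (Finset.range_mono hm) fun j _ hj => by
          rw [hbn j (by simpa using hj), zero_smul]).symm
    have e2 : ∀ m, T m (∑ j ∈ Finset.range n, b j • x j) = ∑ j ∈ Finset.range m, b j • x j :=
      fun m => by simp only [hT, hfb b n _ hbn]
    refine ⟨fun m => ?_, ?_⟩
    · rw [e2, ← e1 _ (le_max_right m n)]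
      exact h b _ _ (le_max_left _ _)
    · exact tendsto_const_nhds.congr' <| (eventually_ge_atTop n).mono fun m hm => by
        dsimp only
        rw [e2, e1 m hm]
  have hTc : ∀ v ∈ S.topologicalClosure, ∀ n, ‖T n v‖ ≤ C * ‖v‖ := by
    intro v hv n
    have hcl : IsClosed {w | ‖T n w‖ ≤ C * ‖w‖} :=
      isClosed_le (T n).continuous.norm (continuous_const.mul continuous_norm)
    exact closure_minimal (fun w hw => (hTS w hw).1 n) hcl hv
  -- The uniform bound `C` on the partial sum operators carries convergence from the span to its
  -- closure; `C + 2` collects the three error terms.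
  have hTt : ∀ v ∈ S.topologicalClosure, Tendsto (fun n => T n v) atTop (𝓝 v) := by
    intro v hv
    rw [Metric.tendsto_atTop]
    intro ε hε
    obtain ⟨w, hw, hvw⟩ := Metric.mem_closure_iff.1 hv (ε / (C + 2)) (by positivity)
    obtain ⟨n, hn⟩ := Metric.tendsto_atTop.1 (hTS w hw).2 (ε / (C + 2)) (by positivity)
    refine ⟨n, fun m hm => ?_⟩
    have h1 := hn m hm
    have h2 := hTc (v - w) (Submodule.sub_mem _ hv (S.le_topologicalClosure hw)) m
    rw [dist_eq_norm] at h1 hvw ⊢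
    have e : T m v - v = T m (v - w) + (T m w - w) - (v - w) := by
      rw [map_sub]
      abel
    rw [e]
    have h3 := norm_sub_le (T m (v - w) + (T m w - w)) (v - w)
    have h4 := norm_add_le (T m (v - w)) (T m w - w)
    have h5 : C * ‖v - w‖ ≤ C * (ε / (C + 2)) := by gcongr
    have h6 : C * (ε / (C + 2)) + ε / (C + 2) + ε / (C + 2) = ε := by field_simp; ring
    linarith
  refine ⟨{ basis := fun i => ⟨x i, S.le_topologicalClosure (Submodule.subset_span ⟨i, rfl⟩)⟩
            coord := fun i => (f i).comp S.topologicalClosure.subtypeL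
            ortho := fun i j => ?_
            expansion := fun v => ?_ }, fun i => rfl⟩
  · simp [hf, Pi.single_apply]
  · rw [HasSum, SummationFilter.conditional_filter_eq_map_range, tendsto_map'_iff,
      tendsto_subtype_rng]
    refine (hTt v v.2).congr fun n => ?_
    simp [hT]

end Grunblum

/-! ### Selecting a sequence that generates a spreading model -/

/-- Recursion in which the requirement on a term may involve all the earlier terms. -/
theorem exists_seq_of_forall_history {I : Type*} {Q : (j : ℕ) → (Fin j → I) → I → Prop}
    (h : ∀ j g, ∃ i, Q j g i) : ∃ s : ℕ → I, ∀ j, Q j (fun l => s l) (s j) := by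
  choose f hf using h
  let s : ℕ → I := (Nat.lt_wfRel.wf).fix fun n ih => f n fun l => ih l.1 l.2
  have hs : ∀ n, s n = f n fun l => s l := fun n => WellFounded.fix_eq _ _ n
  refine ⟨s, fun j => ?_⟩
  rw [hs j]
  exact hf _ _

/-- Pointwise convergence of functions with a common Lipschitz constant is uniform on compact sets,
by a finite net. -/
theorem eventually_forall_abs_sub_le {I E : Type*} [PseudoMetricSpace E] {K : Set E}
    (hK : IsCompact K) {V : Filter I} [V.NeBot] {H : I → E → ℝ} {G : E → ℝ} {C : ℝ} (hC : 0 ≤ C)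
    (hL : ∀ i x x', |H i x - H i x'| ≤ C * dist x x')
    (h : ∀ x, Tendsto (fun i => H i x) V (𝓝 (G x))) {ε : ℝ} (hε : 0 < ε) :
    ∀ᶠ i in V, ∀ x ∈ K, |H i x - G x| ≤ ε := by
  have hG : ∀ x x', |G x - G x'| ≤ C * dist x x' := fun x x' =>
    le_of_tendsto ((h x).sub (h x')).abs (Eventually.of_forall fun i => hL i x x')
  obtain ⟨t, -, htf, htc⟩ := hK.finite_cover_balls (e := ε / (3 * (C + 1))) (by positivity)
  have h1 : ∀ᶠ i in V, ∀ x ∈ t, |H i x - G x| < ε / 3 :=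
    (eventually_all_finite htf).2 fun x _ => by
      simpa [Real.dist_eq] using Metric.tendsto_nhds.1 (h x) (ε / 3) (by positivity)
  filter_upwards [h1] with i hi x hx
  obtain ⟨x', hx', hxx⟩ := Set.mem_iUnion₂.1 (htc hx)
  have h2 : C * dist x x' ≤ ε / 3 := by
    have h3 : (C + 1) * (ε / (3 * (C + 1))) = ε / 3 := by field_simp
    have h4 : dist x x' ≤ ε / (3 * (C + 1)) := (Metric.mem_ball.1 hxx).le
    calc C * dist x x' ≤ (C + 1) * (ε / (3 * (C + 1))) := by gcongr; linarith
      _ = ε / 3 := h3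
  have h3 := abs_le.1 ((hL i x x').trans h2)
  have h4 := abs_le.1 ((hG x x').trans h2)
  have h5 := abs_lt.1 (hi x' hx')
  rw [abs_le]
  constructor <;> linarith [h3.1, h3.2, h4.1, h4.2, h5.1, h5.2]

/-! ### One step of the selection: estimates uniform over bounded coefficients. -/

section stages

variable {I X : Type*} [NormedAddCommGroup X] [NormedSpace ℝ X] {V : Ultrafilter I} {y : I → X}

theorem exists_bound_smul (hy1 : ∀ i, ‖y i‖ ≤ 1) {n : ℕ} (a : Fin n → ℝ) (j : Fin n) :
    ∃ C, ∀ i, ‖a j • y i‖ ≤ C :=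
  ⟨|a j|, fun i => by
    rw [norm_smul, Real.norm_eq_abs]
    exact mul_le_of_le_one_right (abs_nonneg _) (hy1 i)⟩

theorem tendsto_smul_weaklyNull (hw : ∀ f : StrongDual ℝ X, Tendsto (fun i => f (y i)) V (𝓝 0))
    (c : ℝ) (f : StrongDual ℝ X) : Tendsto (fun i => f (c • y i)) V (𝓝 0) := by
  simpa using (hw f).const_mul c

/-- A weakly null sequence is eventually almost monotone basic over a finite-dimensional space. -/
theorem eventually_norm_le_norm_add_smul (hy1 : ∀ i, ‖y i‖ ≤ 1) (hy : ∀ᶠ i in V, ‖y i‖ = 1)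
    (hw : ∀ f : StrongDual ℝ X, Tendsto (fun i => f (y i)) V (𝓝 0)) (S : Submodule ℝ X)
    [FiniteDimensional ℝ S] {θ : ℝ} (hθ1 : θ < 1) :
    ∀ᶠ i in V, ∀ v ∈ S, ∀ t : ℝ, θ * ‖v‖ ≤ ‖v + t • y i‖ := by
  have hlim : ∀ p : S × ℝ, ∃ L, Tendsto (fun i => ‖(p.1 : X) + p.2 • y i‖) V (𝓝 L) := fun p =>
    exists_tendsto_of_bounded V (C := ‖p.1‖ + |p.2|) fun i => by
      rw [abs_norm]
      refine (norm_add_le _ _).trans ?_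
      rw [norm_smul, Real.norm_eq_abs]
      gcongr
      · rfl
      · exact mul_le_of_le_one_right (abs_nonneg _) (hy1 i)
  choose G hG using hlim
  have hGv : ∀ p : S × ℝ, ‖p.1‖ ≤ G p := fun p =>
    le_of_tendsto_of_convexOn (F := norm) continuous_norm convexOn_univ_norm
      (tendsto_smul_weaklyNull hw p.2) (hG p)
  have hev := eventually_forall_abs_sub_le
    ((isCompact_sphere (0 : S) 1).prod (isCompact_Icc (a := (-2 : ℝ)) (b := 2))) (V := (V : Filter I))
    (H := fun i p => ‖(p.1 : X) + p.2 • y i‖) (G := G) (C := 2) (by norm_num)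
    (fun i p p' => by
      refine (abs_norm_sub_norm_le _ _).trans ?_
      have e : (p.1 : X) + p.2 • y i - (p'.1 + p'.2 • y i)
          = ((p.1 - p'.1 : S) : X) + (p.2 - p'.2) • y i := by
        push_cast
        rw [sub_smul]
        abel
      rw [e]
      refine (norm_add_le _ _).trans ?_
      have h1 : ‖((p.1 - p'.1 : S) : X)‖ ≤ dist p p' := by
        have : dist p.1 p'.1 ≤ dist p p' := le_max_left _ _
        rwa [dist_eq_norm] at this
      have h2 : ‖(p.2 - p'.2) • y i‖ ≤ dist p p' := by
        have : dist p.2 p'.2 ≤ dist p p' := le_max_right _ _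
        rw [norm_smul]
        rw [dist_eq_norm] at this
        exact (mul_le_of_le_one_right (norm_nonneg _) (hy1 i)).trans this
      linarith) hG (ε := 1 - θ) (by linarith)
  filter_upwards [hev, hy] with i hi hyi v hv t
  rcases eq_or_ne v 0 with rfl | hv0
  · simp
  have hpos : 0 < ‖v‖ := norm_pos_iff.2 hv0
  have hscale : ‖v + t • y i‖ = ‖v‖ * ‖‖v‖⁻¹ • v + (‖v‖⁻¹ * t) • y i‖ := by
    rw [mul_smul, ← smul_add, norm_smul, norm_inv, norm_norm, mul_inv_cancel_left₀ hpos.ne']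
  rw [hscale, mul_comm]
  gcongr
  set t' := ‖v‖⁻¹ * t with ht'
  have hv1 : ‖‖v‖⁻¹ • v‖ = 1 := by
    rw [norm_smul, norm_inv, norm_norm, inv_mul_cancel₀ hpos.ne']
  -- Compactness handles bounded `t'`. For `|t'| > 2` the triangle inequality already gives a norm
  -- above `|t'| - 1 > 1`.
  by_cases ht : |t'| ≤ 2
  · have h1 := hi (⟨‖v‖⁻¹ • v, S.smul_mem _ hv⟩, t') ⟨by simpa using hv1, abs_le.1 ht⟩
    have h2 := hGv (⟨‖v‖⁻¹ • v, S.smul_mem _ hv⟩, t')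
    have h3 : ‖(⟨‖v‖⁻¹ • v, S.smul_mem _ hv⟩ : S)‖ = 1 := hv1
    have h4 := (abs_le.1 h1).1
    dsimp only at h2 h4
    linarith
  · have h1 := norm_sub_le (‖v‖⁻¹ • v + t' • y i) (‖v‖⁻¹ • v)
    rw [add_sub_cancel_left, norm_smul, hyi, mul_one, Real.norm_eq_abs, hv1] at h1
    linarith

/-- The inner limits in an iterated limit are attained uniformly over bounded coefficients. -/
theorem eventually_abs_iterLim_sub_le (hy1 : ∀ i, ‖y i‖ ≤ 1) {j : ℕ} (g : Fin j → I) (q : ℕ)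
    {δ : ℝ} (hδ : 0 < δ) :
    ∀ᶠ i in V, ∀ b : Fin j → ℝ, (∀ l, |b l| ≤ 1) → ∀ c : Fin (q + 1) → ℝ, (∀ l, |c l| ≤ 1) →
      |iterLim V norm (fun s i' => c (Fin.succ s) • y i') (∑ l, b l • y (g l) + c 0 • y i)
        - iterLim V norm (fun s i' => c s • y i') (∑ l, b l • y (g l))| ≤ δ := by
  have hev := eventually_forall_abs_sub_le
    ((isCompact_univ_pi fun _ : Fin j => isCompact_Icc (a := (-1 : ℝ)) (b := 1)).prod
      (isCompact_univ_pi fun _ : Fin (q + 1) => isCompact_Icc (a := (-1 : ℝ)) (b := 1)))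
    (V := (V : Filter I))
    (H := fun i p => iterLim V norm (fun s i' => p.2 (Fin.succ s) • y i')
      (∑ l, p.1 l • y (g l) + p.2 0 • y i))
    (G := fun p => iterLim V norm (fun s i' => p.2 s • y i') (∑ l, p.1 l • y (g l)))
    (C := j + 1 + q) (by positivity)
    (fun i p p' => by
      have h1 : ∀ l, |p.1 l - p'.1 l| ≤ dist p p' := fun l =>
        (dist_le_pi_dist p.1 p'.1 l).trans (le_max_left _ _)
      have h2 : ∀ l, |p.2 l - p'.2 l| ≤ dist p p' := fun l =>
        (dist_le_pi_dist p.2 p'.2 l).trans (le_max_right _ _)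
      have hsm : ∀ (r : ℝ) i, |r| ≤ dist p p' → ‖r • y i‖ ≤ dist p p' := fun r i hr => by
        rw [norm_smul]
        exact (mul_le_of_le_one_right (norm_nonneg _) (hy1 i)).trans hr
      refine (abs_iterLim_sub_le lipschitzWith_one_norm
        (exists_bound_smul hy1 fun s : Fin q => p.2 s.succ)
        (exists_bound_smul hy1 fun s : Fin q => p'.2 s.succ) (B := fun _ => dist p p')
        (fun s i => by
          rw [← sub_smul]
          exact hsm _ _ (h2 _)) _ _).trans ?_
      have e : ∑ l, p.1 l • y (g l) + p.2 0 • y i - (∑ l, p'.1 l • y (g l) + p'.2 0 • y i)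
          = ∑ l, (p.1 l - p'.1 l) • y (g l) + (p.2 0 - p'.2 0) • y i := by
        simp only [sub_smul, Finset.sum_sub_distrib]
        abel
      have h3 : ‖∑ l, (p.1 l - p'.1 l) • y (g l)‖ ≤ j * dist p p' := by
        refine (norm_sum_le_of_le _ fun l _ => hsm _ _ (h1 l)).trans ?_
        simp
      have h4 := norm_add_le (∑ l, (p.1 l - p'.1 l) • y (g l)) ((p.2 0 - p'.2 0) • y i)
      have h5 := hsm _ i (h2 0)
      rw [e]
      simp only [Finset.sum_const, Finset.card_univ, Fintype.card_fin, nsmul_eq_mul]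
      linarith)
    (fun p => tendsto_iterLim_succ lipschitzWith_one_norm (exists_bound_smul hy1 p.2) _) hδ
  filter_upwards [hev] with i hi b hb c hc
  exact hi (b, c) ⟨fun l _ => abs_le.1 (hb l), fun l _ => abs_le.1 (hc l)⟩

/-- For the outermost index the limit is at least both `‖v‖` and `|a 0| - ‖v‖`, hence at least half
of `|a 0|`. This lower bound later turns additive errors into multiplicative ones. -/
theorem half_abs_le_iterLim (hy1 : ∀ i, ‖y i‖ ≤ 1) (hy : ∀ᶠ i in V, ‖y i‖ = 1)
    (hw : ∀ f : StrongDual ℝ X, Tendsto (fun i => f (y i)) V (𝓝 0)) {n : ℕ} (a : Fin n → ℝ)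
    (j : Fin n) (v : X) : |a j| / 2 ≤ iterLim V norm (fun j i => a j • y i) v := by
  induction n generalizing v with
  | zero => exact j.elim0
  | succ n ih =>
    have hs := tendsto_iterLim_succ (U := V) lipschitzWith_one_norm (exists_bound_smul hy1 a) v
    refine Fin.cases ?_ (fun j => ?_) j
    · have h1 : ‖v‖ ≤ iterLim V norm (fun j i => a j • y i) v :=
        le_iterLim lipschitzWith_one_norm convexOn_univ_norm (exists_bound_smul hy1 a)
          (fun j => tendsto_smul_weaklyNull hw (a j)) v
      have h2 : |a 0| - ‖v‖ ≤ iterLim V norm (fun j i => a j • y i) v := by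
        refine ge_of_tendsto hs ?_
        filter_upwards [hy] with i hi
        have h3 : ‖v + a 0 • y i‖ ≤ _ := le_iterLim (U := V) lipschitzWith_one_norm
          convexOn_univ_norm (exists_bound_smul hy1 fun j : Fin n => a j.succ)
          (fun j => tendsto_smul_weaklyNull hw (a j.succ)) (v + a 0 • y i)
        refine le_trans ?_ h3
        have h4 := norm_sub_le (v + a 0 • y i) v
        rw [add_sub_cancel_left, norm_smul, hi, mul_one, Real.norm_eq_abs] at h4
        linarith
      linarith
    · exact ge_of_tendsto hs (Eventually.of_forall fun i => ih (fun j => a j.succ) j _)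

end stages

section selection

variable {X : Type*} [NormedAddCommGroup X] [NormedSpace ℝ X]

theorem abs_norm_linearCombination_le {w : ℕ → X} (hw : ∀ i, ‖w i‖ ≤ 1) (f : ℕ →₀ ℝ) (m : ℕ) :
    |‖Finsupp.linearCombination ℝ (fun i => w (m + i)) f‖| ≤ ∑ i ∈ f.support, |f i| := by
  rw [abs_norm, Finsupp.linearCombination_apply, Finsupp.sum]
  refine norm_sum_le_of_le _ fun i _ => ?_
  rw [norm_smul, Real.norm_eq_abs]
  exact mul_le_of_le_one_right (abs_nonneg _) (hw _)

/-- The seminorm on `c₀₀` obtained as the limit of the norms on the tails of a sequence. -/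
noncomputable def tailSeminorm (w : ℕ → X) (hw : ∀ i, ‖w i‖ ≤ 1) : Seminorm ℝ (ℕ →₀ ℝ) :=
  have hlim : ∀ f : ℕ →₀ ℝ, Tendsto
      (fun m => ‖Finsupp.linearCombination ℝ (fun i => w (m + i)) f‖) (hyperfilter ℕ)
      (𝓝 (limUnder (hyperfilter ℕ : Filter ℕ)
        fun m => ‖Finsupp.linearCombination ℝ (fun i => w (m + i)) f‖)) := fun f =>
    tendsto_nhds_limUnder (exists_tendsto_of_bounded _ (abs_norm_linearCombination_le hw f))
  Seminorm.of
    (fun f => limUnder (hyperfilter ℕ : Filter ℕ)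
      fun m => ‖Finsupp.linearCombination ℝ (fun i => w (m + i)) f‖)
    (fun f g => le_of_tendsto_of_tendsto (hlim (f + g)) ((hlim f).add (hlim g))
      (Eventually.of_forall fun m => by
        dsimp only
        rw [map_add]
        exact norm_add_le _ _))
    (fun c f => tendsto_nhds_unique (hlim (c • f)) (by
      simpa only [map_smul, norm_smul] using (hlim f).const_mul ‖c‖))

theorem tendsto_tailSeminorm {w : ℕ → X} (hw : ∀ i, ‖w i‖ ≤ 1) (f : ℕ →₀ ℝ) :
    Tendsto (fun m => ‖Finsupp.linearCombination ℝ (fun i => w (m + i)) f‖) (hyperfilter ℕ)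
      (𝓝 (tailSeminorm w hw f)) :=
  tendsto_nhds_limUnder (exists_tendsto_of_bounded _ (abs_norm_linearCombination_le hw f))

variable {I : Type*} {V : Ultrafilter I} {y : I → X}

/-- If each term of `s` approximates the inner limits, then the norm of a combination of terms is
close to the iterated limit. -/
theorem abs_norm_sub_iterLim_le {s : ℕ → I} {δ : ℕ → ℝ} (hδ : Antitone δ)
    (hs : ∀ j, ∀ q ≤ j, ∀ b : Fin j → ℝ, (∀ l, |b l| ≤ 1) → ∀ c : Fin (q + 1) → ℝ,
      (∀ l, |c l| ≤ 1) →
      |iterLim V norm (fun t i' => c (Fin.succ t) • y i') (∑ l, b l • y (s l) + c 0 • y (s j))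
        - iterLim V norm (fun t i' => c t • y i') (∑ l, b l • y (s l))| ≤ δ j)
    (M : ℕ) {n : ℕ} {c : Fin n → ℝ} (hc : ∀ l, |c l| ≤ 1) {k : Fin n → ℕ} (hk : StrictMono k)
    (hn : ∀ i, n ≤ k i + 1) (hM : ∀ i, M ≤ k i) {j : ℕ} (hj : ∀ i, j ≤ k i) {b : ℕ → ℝ}
    (hb : ∀ l, |b l| ≤ 1) (hbj : ∀ l, j ≤ l → b l = 0) :
    |‖∑ l ∈ Finset.range j, b l • y (s l) + ∑ i, c i • y (s (k i))‖
      - iterLim V norm (fun t i' => c t • y i') (∑ l ∈ Finset.range j, b l • y (s l))|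
      ≤ n * δ M := by
  induction n generalizing j b with
  | zero => simp [iterLim_zero]
  | succ n ih =>
    have e1 : ∑ l ∈ Finset.range j, b l • y (s l) = ∑ l : Fin (k 0), b l • y (s l) := by
      rw [Fin.sum_univ_eq_sum_range (fun l => b l • y (s l)) (k 0)]
      exact Finset.sum_subset (Finset.range_mono (hj 0)) fun l _ hl => by
        rw [hbj l (by simpa using hl), zero_smul]
    have h1 := hs (k 0) n (by have := hn 0; omega) (fun l => b l) (fun l => hb l) c hc
    -- The term with index `k 0` joins the vectors already fixed, so that the induction can continue
    -- from position `k 0 + 1`.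
    set b' : ℕ → ℝ := fun l => if l < k 0 then b l else if l = k 0 then c 0 else 0 with hb'
    have e2 : ∑ l ∈ Finset.range (k 0 + 1), b' l • y (s l)
        = ∑ l ∈ Finset.range j, b l • y (s l) + c 0 • y (s (k 0)) := by
      rw [Finset.sum_range_succ, e1, Fin.sum_univ_eq_sum_range (fun l => b l • y (s l)) (k 0)]
      congr 1
      · exact Finset.sum_congr rfl fun l hl => by simp [hb', Finset.mem_range.1 hl]
      · simp [hb']
    have h2 := ih (c := fun i => c i.succ) (fun l => hc _) (k := fun i => k i.succ)
      (fun i i' hii => hk (by simpa using hii)) (fun i => by have := hn i.succ; omega)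
      (fun i => hM _) (j := k 0 + 1) (fun i => hk (Fin.succ_pos i)) (b := b')
      (fun l => by
        simp only [hb']
        split_ifs
        exacts [hb l, hc 0, by simp])
      (fun l hl => by
        have h3 : ¬ l < k 0 := by omega
        have h4 : ¬ l = k 0 := by omega
        simp [hb', h3, h4])
    rw [e2] at h2
    rw [← e1] at h1
    rw [Fin.sum_univ_succ, ← add_assoc]
    have h5 : δ (k 0) ≤ δ M := hδ (hM 0)
    have h6 := abs_le.1 h1
    have h7 := abs_le.1 h2
    push_cast
    rw [abs_le]
    constructor <;> linarith [h6.1, h6.2, h7.1, h7.2]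

end selection

section selection

variable {I X : Type*} [NormedAddCommGroup X] [NormedSpace ℝ X] {V : Ultrafilter I} {y : I → X}

theorem iterLim_norm_mul (hy1 : ∀ i, ‖y i‖ ≤ 1) {c : ℝ} (hc : 0 ≤ c) {n : ℕ} (a : Fin n → ℝ) :
    iterLim V norm (fun j i => (c * a j) • y i) 0 = c * iterLim V norm (fun j i => a j • y i) 0 := by
  refine tendsto_nhds_unique
    (tendsto_iterLim_norm_zero (exists_bound_smul hy1 fun j => c * a j)) ?_
  have h1 := (tendsto_iterLim_norm_zero (U := V) (exists_bound_smul hy1 a)).const_mul c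
  simpa only [mul_smul, ← Finset.smul_sum, norm_smul, Real.norm_of_nonneg hc] using h1

/-- The bounds that a spreading model has to satisfy follow from an estimate with a small additive
error on coefficient vectors in the unit cube. -/
theorem spreading_bounds_of_abs_sub_le {w : ℕ → X} {N : Seminorm ℝ (ℕ →₀ ℝ)} {n : ℕ}
    {k : Fin n → ℕ}
    (hN : ∀ a : Fin n → ℝ, (∀ i, |a i| ≤ 1) →
      |‖∑ i, a i • w (k i)‖ - N (∑ i : Fin n, Finsupp.single (i : ℕ) (a i))| ≤ 1 / (4 * (n + 1)))
    (hN2 : ∀ (a : Fin n → ℝ) (j : Fin n), (∀ i, |a i| ≤ 1) →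
      |a j| / 2 ≤ N (∑ i : Fin n, Finsupp.single (i : ℕ) (a i))) (a : Fin n → ℝ) :
    (1 + 1 / ((n : ℝ) + 1))⁻¹ * N (∑ i : Fin n, Finsupp.single (i : ℕ) (a i))
        ≤ ‖∑ i : Fin n, a i • w (k i)‖ ∧
      ‖∑ i : Fin n, a i • w (k i)‖
        ≤ (1 + 1 / ((n : ℝ) + 1)) * N (∑ i : Fin n, Finsupp.single (i : ℕ) (a i)) := by
  rcases isEmpty_or_nonempty (Fin n) with hn | hn
  · simp
  obtain ⟨j, hj⟩ := Finite.exists_max fun i => |a i|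
  rcases (abs_nonneg (a j)).eq_or_lt with h0 | hpos
  · have : ∀ i, a i = 0 := fun i =>
      abs_eq_zero.1 (le_antisymm (by rw [h0]; exact hj i) (abs_nonneg _))
    simp [this]
  set r := |a j| with hr
  set b : Fin n → ℝ := fun i => a i / r with hb
  have hab : a = fun i => r * b i := by
    ext i
    simp only [hb]
    field_simp
  have hb1 : ∀ i, |b i| ≤ 1 := fun i => by
    rw [hb, abs_div, abs_of_pos hpos, div_le_one hpos]
    exact hj i
  have hbj : |b j| = 1 := by
    rw [hb, abs_div, abs_of_pos hpos, ← hr, div_self hpos.ne']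
  have h1 := abs_le.1 (hN b hb1)
  -- After scaling the largest coefficient to modulus `1` the seminorm is at least `1 / 2`, so an
  -- additive error `η / 4` is absorbed by the factor `1 + η`, as `η ≤ 1`.
  have h2 := hN2 b j hb1
  rw [hbj] at h2
  rw [hab]
  simp only [mul_smul, ← Finset.smul_sum, norm_smul, sum_single_smul, map_smul_eq_mul,
    Real.norm_of_nonneg hpos.le]
  set A := ‖∑ i, b i • w (k i)‖
  set B := N (∑ i : Fin n, Finsupp.single (i : ℕ) (b i))
  have hη : (0 : ℝ) < 1 / (n + 1) := by positivity
  have hη1 : (1 : ℝ) / (n + 1) ≤ 1 := by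
    rw [div_le_one (by positivity)]
    linarith [(Nat.cast_nonneg n : (0 : ℝ) ≤ n)]
  have e : (1 : ℝ) / (4 * (n + 1)) = 1 / (n + 1) / 4 := by field_simp
  rw [e] at h1
  set η : ℝ := 1 / (n + 1)
  constructor
  · rw [inv_mul_le_iff₀ (by positivity)]
    have : B ≤ (1 + η) * A := by nlinarith
    nlinarith
  · have : A ≤ (1 + η) * B := by nlinarith
    nlinarith

/-- From a normalized family that is weakly null along an ultrafilter one can select a basic
sequence that generates a spreading model, given by the iterated limits along the ultrafilter. -/
theorem exists_generatesSpreadingModel (hy1 : ∀ i, ‖y i‖ ≤ 1) (hy : ∀ᶠ i in V, ‖y i‖ = 1)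
    (hw : ∀ f : StrongDual ℝ X, Tendsto (fun i => f (y i)) V (𝓝 0)) {A : ℕ → Set I}
    (hA : ∀ j, A j ∈ V) :
    ∃ (s : ℕ → I) (N : Seminorm ℝ (ℕ →₀ ℝ)), (∀ j, s j ∈ A j) ∧
      GeneratesSpreadingModel (fun j => y (s j)) N ∧
      ∀ (n : ℕ) (a : Fin n → ℝ), N (∑ i : Fin n, Finsupp.single (i : ℕ) (a i))
        = iterLim V norm (fun j i => a j • y i) 0 := by
  -- Adding the `j`-th vector may shrink norms by the factor `κ j / κ (j + 1)`. These factors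
  -- telescope, and `1 ≤ κ ≤ 2` gives the basis constant `2`.
  let κ : ℕ → ℝ := fun j => 2 - 1 / ((j : ℝ) + 1)
  -- A combination of length `n` uses indices at least `n - 1`, and `n * δ (n - 1) = n / (4 * (n +
  -- 1) ^ 2)` is below the tolerance `1 / (4 * (n + 1))` of `spreading_bounds_of_abs_sub_le`.
  let δ : ℕ → ℝ := fun j => 1 / (4 * ((j : ℝ) + 2) ^ 2)
  have hκ1 : ∀ j, 1 ≤ κ j := fun j => by
    have : (1 : ℝ) / (j + 1) ≤ 1 := by
      rw [div_le_one (by positivity)]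
      linarith [(Nat.cast_nonneg j : (0 : ℝ) ≤ j)]
    simp only [κ]
    linarith
  have hκ2 : ∀ j, κ j ≤ 2 := fun j => by
    have : (0 : ℝ) < 1 / (j + 1) := by positivity
    simp only [κ]
    linarith
  have hκ : ∀ j, κ j < κ (j + 1) := fun j => by
    have : (1 : ℝ) / ((j + 1 : ℕ) + 1) < 1 / (j + 1) := by
      gcongr
      simp
    simp only [κ]
    linarith
  have hδ : Antitone δ := fun i j hij => by
    have : (i : ℝ) ≤ j := by exact_mod_cast hij
    simp only [δ]
    gcongr
  have hδ0 : Tendsto δ atTop (𝓝 0) := by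
    refine squeeze_zero (fun j => by positivity) (fun j => ?_)
      tendsto_one_div_add_atTop_nhds_zero_nat
    simp only [δ]
    gcongr
    nlinarith [(Nat.cast_nonneg j : (0 : ℝ) ≤ j)]
  obtain ⟨s, hs⟩ := exists_seq_of_forall_history
    (Q := fun j g i => i ∈ A j ∧ ‖y i‖ = 1 ∧
      (∀ v ∈ Submodule.span ℝ (Set.range fun l => y (g l)), ∀ t : ℝ,
        κ j / κ (j + 1) * ‖v‖ ≤ ‖v + t • y i‖) ∧
      -- Finitely many `q` suffice at stage `j`: in a combination of length `q + 1` starting at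
      -- index `j`, admissibility forces `q ≤ j`.
      ∀ q ∈ Finset.range (j + 1), ∀ b : Fin j → ℝ, (∀ l, |b l| ≤ 1) → ∀ c : Fin (q + 1) → ℝ,
        (∀ l, |c l| ≤ 1) →
        |iterLim V norm (fun t i' => c (Fin.succ t) • y i') (∑ l, b l • y (g l) + c 0 • y i)
          - iterLim V norm (fun t i' => c t • y i') (∑ l, b l • y (g l))| ≤ δ j)
    (fun j g => by
      have : FiniteDimensional ℝ (Submodule.span ℝ (Set.range fun l => y (g l))) :=
        FiniteDimensional.span_of_finite ℝ (Set.finite_range _)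
      have h1 := eventually_norm_le_norm_add_smul (V := V) hy1 hy hw
        (Submodule.span ℝ (Set.range fun l => y (g l))) (θ := κ j / κ (j + 1))
        ((div_lt_one (by linarith [hκ1 (j + 1)])).2 (hκ j))
      have h2 := (eventually_all_finset (l := (V : Filter I)) (Finset.range (j + 1))).2
        fun q _ => eventually_abs_iterLim_sub_le (V := V) hy1 g q (δ := δ j) (by positivity)
      have hAj : ∀ᶠ i in (V : Filter I), i ∈ A j := hA j
      exact (hAj.and (hy.and (h1.and h2))).exists)
  have hbasic : IsBasicSequence fun j => y (s j) := by
    refine isBasicSequence_of_norm_partial_sum_le (C := 2)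
      (fun i => norm_ne_zero_iff.1 (by rw [(hs i).2.1]; exact one_ne_zero)) fun b m n hmn => ?_
    have hmono : Monotone fun m => κ m * ‖∑ i ∈ Finset.range m, b i • y (s i)‖ :=
      monotone_nat_of_le_succ fun m => by
        have h1 := (hs m).2.2.1 (∑ i ∈ Finset.range m, b i • y (s i))
          (Submodule.sum_mem _ fun i hi => Submodule.smul_mem _ _
            (Submodule.subset_span ⟨⟨i, Finset.mem_range.1 hi⟩, rfl⟩)) (b m)
        rwa [← Finset.sum_range_succ (fun i => b i • y (s i)), div_mul_eq_mul_div,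
          div_le_iff₀' (by linarith [hκ1 (m + 1)])] at h1
    have h2 := hmono hmn
    dsimp only at h2
    have h3 := hκ1 m
    have h4 := hκ2 n
    have h5 := norm_nonneg (∑ i ∈ Finset.range m, b i • y (s i))
    have h6 := norm_nonneg (∑ i ∈ Finset.range n, b i • y (s i))
    nlinarith
  let w : ℕ → X := fun j => y (s j)
  have hw1 : ∀ i, ‖w i‖ ≤ 1 := fun i => hy1 _
  have hest : ∀ (M n : ℕ) (a : Fin n → ℝ), (∀ i, |a i| ≤ 1) → ∀ k : Fin n → ℕ, StrictMono k →
      (∀ i, n ≤ k i + 1) → (∀ i, M ≤ k i) →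
      |‖∑ i, a i • w (k i)‖ - iterLim V norm (fun j i => a j • y i) 0| ≤ n * δ M := by
    intro M n a ha k hk hkn hkM
    have := abs_norm_sub_iterLim_le (V := V) (y := y) hδ (fun j q hq =>
      (hs j).2.2.2 q (Finset.mem_range_succ_iff.2 hq)) M ha hk hkn hkM (j := 0)
      (fun _ => Nat.zero_le _) (b := fun _ => 0) (fun _ => by simp) (fun _ _ => rfl)
    simpa using this
  have hNcube : ∀ (n : ℕ) (a : Fin n → ℝ), (∀ i, |a i| ≤ 1) →
      tailSeminorm w hw1 (∑ i : Fin n, Finsupp.single (i : ℕ) (a i))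
        = iterLim V norm (fun j i => a j • y i) 0 := by
    intro n a ha
    refine tendsto_nhds_unique (tendsto_tailSeminorm hw1 _) ?_
    refine Tendsto.mono_left ?_ (Nat.hyperfilter_le_atTop)
    rw [tendsto_iff_dist_tendsto_zero]
    refine squeeze_zero' (Eventually.of_forall fun _ => dist_nonneg) ?_
      (by simpa using hδ0.const_mul (n : ℝ))
    filter_upwards [eventually_ge_atTop n] with m hm
    have := hest m n a ha (fun i => m + i) (fun i j hij => by simpa using hij)
      (fun i => by omega) (fun i => by omega)
    simpa [Real.dist_eq, map_sum] using this
  have hN : ∀ (n : ℕ) (a : Fin n → ℝ),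
      tailSeminorm w hw1 (∑ i : Fin n, Finsupp.single (i : ℕ) (a i))
        = iterLim V norm (fun j i => a j • y i) 0 := by
    intro n a
    obtain ⟨c, b, hc, hb, rfl⟩ := exists_eq_mul_mem_Icc a
    rw [sum_single_smul, map_smul_eq_mul, hNcube n b fun i => abs_le.2 (hb i),
      iterLim_norm_mul hy1 hc, Real.norm_of_nonneg hc]
  refine ⟨s, tailSeminorm w hw1, fun j => (hs j).1, ⟨fun i => (hs i).2.1, hbasic,
    fun n => 1 / ((n : ℝ) + 1), fun i j hij => ?_, tendsto_one_div_add_atTop_nhds_zero_nat,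
    fun n a _ k hk hkn => ?_⟩, hN⟩
  · have : (i : ℝ) ≤ j := by exact_mod_cast hij
    dsimp only
    gcongr
  · refine spreading_bounds_of_abs_sub_le (w := w) (fun a ha => ?_)
      (fun a j ha => by rw [hN]; exact half_abs_le_iterLim hy1 hy hw a j 0) a
    rw [hN]
    refine (hest (n - 1) n a ha k hk hkn fun i => by have := hkn i; omega).trans ?_
    rcases Nat.eq_zero_or_pos n with rfl | hn
    · simp
    · obtain ⟨m, rfl⟩ := Nat.exists_eq_succ_of_ne_zero hn.ne'
      simp only [δ, Nat.succ_sub_one, Nat.succ_eq_add_one]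
      push_cast
      rw [mul_one_div, div_le_div_iff₀ (by positivity) (by positivity)]
      nlinarith [(Nat.cast_nonneg m : (0 : ℝ) ≤ m)]

end selection

/-! ### Comparison of iterated limits along different ultrafilters. -/

section comparison

variable {X : Type*} [NormedAddCommGroup X]

/-- Allows the iterated limit of one component sequence to be computed when its indices are read off
from a larger index set. -/
theorem tendsto_iterPow_map {I J : Type*} (U : Ultrafilter I) (g : I → J) (n : ℕ) :
    Tendsto (fun k : Fin n → I => g ∘ k) (iterPow U n) (iterPow (U.map g) n) := by
  induction n with
  | zero =>
    intro s hs
    have : Fin.elim0 ∈ s := hs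
    show g ∘ Fin.elim0 ∈ s
    rwa [Subsingleton.elim (g ∘ Fin.elim0) Fin.elim0]
  | succ n ih =>
    intro s hs
    have h1 : ∀ᶠ i in (U : Filter I), ∀ᶠ k in (iterPow (U.map g) n : Filter (Fin n → J)),
        Fin.cons (α := fun _ => J) (g i) k ∈ s := hs
    have h2 : ∀ᶠ i in (U : Filter I), ∀ᶠ k in (iterPow U n : Filter (Fin n → I)),
        g ∘ Fin.cons (α := fun _ => I) i k ∈ s := by
      filter_upwards [h1] with i hi
      filter_upwards [ih.eventually hi] with k hk
      rwa [Fin.comp_cons]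
    exact h2

theorem exists_tendsto_lipschitz {I : Type*} (U : Ultrafilter I) {F : X → ℝ}
    (hF : LipschitzWith 1 F) {z : I → X} {C : ℝ} (hz : ∀ i, ‖z i‖ ≤ C) (v : X) :
    ∃ L, Tendsto (fun i => F (v + z i)) U (𝓝 L) :=
  exists_tendsto_of_bounded U (C := |F v| + C) fun i => by
    have := hF.dist_le_mul (v + z i) v
    rw [Real.dist_eq, dist_eq_norm, add_sub_cancel_left, NNReal.coe_one, one_mul] at this
    have h2 := abs_add_le (F v) (F (v + z i) - F v)
    rw [add_sub_cancel] at h2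
    linarith [hz i]

variable [NormedSpace ℝ X]

theorem exists_bound_const_smul {I : Type*} {y : I → X} {C : ℝ} (hy : ∀ i, ‖y i‖ ≤ C) (t : ℝ) :
    ∃ D, ∀ i, ‖t • y i‖ ≤ D :=
  ⟨|t| * C, fun i => by
    rw [norm_smul, Real.norm_eq_abs]
    exact mul_le_mul_of_nonneg_left (hy i) (abs_nonneg _)⟩

/-- Iterated limits of norms are compared one variable at a time. -/
theorem iterLim_le_iterLim {I J : Type*} {U : Ultrafilter I} {V : Ultrafilter J} {z : I → X}
    {y : J → X} {C D : ℝ} (hz : ∀ i, ‖z i‖ ≤ C) (hy : ∀ j, ‖y j‖ ≤ D)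
    (h : ∀ F : X → ℝ, LipschitzWith 1 F → ConvexOn ℝ Set.univ F → ∀ (t : ℝ) (v : X) (L L' : ℝ),
      Tendsto (fun i => F (v + t • z i)) U (𝓝 L) → Tendsto (fun j => F (v + t • y j)) V (𝓝 L') →
      L ≤ L') {n : ℕ} (a : Fin n → ℝ) (v : X) :
    iterLim U norm (fun j i => a j • z i) v ≤ iterLim V norm (fun j i => a j • y i) v := by
  induction n generalizing v with
  | zero => rw [iterLim_zero, iterLim_zero]
  | succ n ih =>
    have hz' : ∀ j, ∃ C, ∀ i, ‖a j • z i‖ ≤ C := fun j => exists_bound_const_smul hz _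
    have hy' : ∀ j, ∃ C, ∀ i, ‖a j • y i‖ ≤ C := fun j => exists_bound_const_smul hy _
    have h1 := tendsto_iterLim_succ (U := U) lipschitzWith_one_norm hz' v
    have h2 := tendsto_iterLim_succ (U := V) lipschitzWith_one_norm hy' v
    have hLip := lipschitzWith_iterLim (U := U) lipschitzWith_one_norm fun j : Fin n => hz' j.succ
    have hcon := convexOn_iterLim (U := U) lipschitzWith_one_norm convexOn_univ_norm
      fun j : Fin n => hz' j.succ
    obtain ⟨D', hD'⟩ := hy' 0
    -- The intermediate quantity has its outermost variable along `y` and all inner ones along `z`.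
    obtain ⟨L, hL⟩ := exists_tendsto_lipschitz V hLip hD' v
    exact (h _ hLip hcon (a 0) v _ L h1 hL).trans
      (le_of_tendsto_of_tendsto hL h2 (Eventually.of_forall fun j => ih _ _))

end comparison

/-! ### Weighted sums of weakly null sequences -/

/-- The ultrafilter on finite tuples of indices obtained by first choosing the length of the tuple
and then its entries, one after the other. -/
noncomputable def tupleUltrafilter : Ultrafilter (Σ r : ℕ, Fin r → ℕ) :=
  (hyperfilter ℕ).bind fun r => (iterPow (hyperfilter ℕ) r).map (Sigma.mk r)

theorem eventually_tupleUltrafilter {P : (Σ r : ℕ, Fin r → ℕ) → Prop} :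
    (∀ᶠ i in (tupleUltrafilter : Filter (Σ r : ℕ, Fin r → ℕ)), P i) ↔
      ∀ᶠ r in (hyperfilter ℕ : Filter ℕ),
        ∀ᶠ k in (iterPow (hyperfilter ℕ) r : Filter (Fin r → ℕ)), P ⟨r, k⟩ :=
  Iff.rfl

/-- The `n`-th entry of a tuple, with default value `0`. -/
def tupleEntry (n : ℕ) (i : Σ r : ℕ, Fin r → ℕ) : ℕ :=
  if h : n < i.1 then i.2 ⟨n, h⟩ else 0

theorem eventually_tupleUltrafilter_ge (j : ℕ) :
    ∀ᶠ i in (tupleUltrafilter : Filter (Σ r : ℕ, Fin r → ℕ)), j ≤ i.1 ∧ ∀ n, j ≤ i.2 n := by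
  rw [eventually_tupleUltrafilter]
  filter_upwards [Nat.hyperfilter_le_atTop (eventually_ge_atTop j)] with r hr
  filter_upwards [eventually_all.2 fun n : Fin r =>
    eventually_iterPow_eval n (Nat.hyperfilter_le_atTop (eventually_ge_atTop j))] with k hk
  exact ⟨hr, hk⟩

theorem map_tupleEntry_le_atTop (n : ℕ) :
    (tupleUltrafilter.map (tupleEntry n) : Filter ℕ) ≤ atTop := by
  rw [Ultrafilter.coe_map]
  refine tendsto_atTop.2 fun j => ?_
  filter_upwards [eventually_tupleUltrafilter_ge (max j (n + 1))] with i hi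
  have h1 : n < i.1 := (le_max_right j (n + 1)).trans hi.1
  simp only [tupleEntry, h1, dif_pos]
  exact (le_max_left _ _).trans (hi.2 _)

section weightedSum

variable {X : Type*} [NormedAddCommGroup X] [NormedSpace ℝ X] {x : ℕ → ℕ → X} {c : ℕ → ℝ}

/-- The weighted sum of the terms of the sequences `x n` at the indices given by a tuple. -/
noncomputable def weightedSum (x : ℕ → ℕ → X) (c : ℕ → ℝ) (i : Σ r : ℕ, Fin r → ℕ) : X :=
  ∑ n : Fin i.1, c n • x n (i.2 n)

theorem weightedSum_eq (i : Σ r : ℕ, Fin r → ℕ) :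
    weightedSum x c i = ∑ n ∈ Finset.range i.1, c n • x n (tupleEntry n i) := by
  rw [weightedSum, ← Fin.sum_univ_eq_sum_range (fun n => c n • x n (tupleEntry n i))]
  simp [tupleEntry]

theorem norm_weightedSum_sub_le (hx : ∀ n i, ‖x n i‖ = 1) (hc0 : ∀ n, 0 < c n)
    (hc : ∀ n, c n ≤ (1 / 2) ^ n) {R : ℕ} {i : Σ r : ℕ, Fin r → ℕ} (hi : R ≤ i.1) :
    ‖weightedSum x c i - ∑ n ∈ Finset.range R, c n • x n (tupleEntry n i)‖
      ≤ 2 * (1 / 2) ^ R := by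
  rw [weightedSum_eq, ← Finset.sum_range_add_sum_Ico _ hi, add_sub_cancel_left]
  refine (norm_sum_le_of_le _ (f := fun n => c n • x n (tupleEntry n i))
    (n := fun n => (1 / 2 : ℝ) ^ n) fun n _ => ?_).trans ?_
  · rw [norm_smul, hx, mul_one, Real.norm_of_nonneg (hc0 n).le]
    exact hc n
  · refine (geom_sum_Ico_le_of_lt_one (by norm_num) (by norm_num)).trans (le_of_eq ?_)
    ring

theorem norm_weightedSum_le (hx : ∀ n i, ‖x n i‖ = 1) (hc0 : ∀ n, 0 < c n)
    (hc : ∀ n, c n ≤ (1 / 2) ^ n) (i : Σ r : ℕ, Fin r → ℕ) : ‖weightedSum x c i‖ ≤ 2 := by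
  simpa using norm_weightedSum_sub_le hx hc0 hc (R := 0) (i := i) (Nat.zero_le _)

/-- The geometric tail is uniformly small and only finitely many sequences remain. The estimate
holds for every tuple with large length and entries, so it also serves an ordinary sequence of such
tuples. -/
theorem exists_forall_abs_weightedSum_le (hx : ∀ n i, ‖x n i‖ = 1) (hc0 : ∀ n, 0 < c n)
    (hc : ∀ n, c n ≤ (1 / 2) ^ n) (hw : ∀ n, IsWeaklyNull (x n)) (f : StrongDual ℝ X) {ε : ℝ}
    (hε : 0 < ε) : ∃ j : ℕ, ∀ i : Σ r : ℕ, Fin r → ℕ, j ≤ i.1 → (∀ n, j ≤ i.2 n) →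
      |f (weightedSum x c i)| ≤ ε := by
  obtain ⟨R, hR⟩ : ∃ R : ℕ, ‖f‖ * (2 * (1 / 2) ^ R) ≤ ε / 2 := by
    have h1 : Tendsto (fun R : ℕ => ‖f‖ * (2 * (1 / 2 : ℝ) ^ R)) atTop (𝓝 (‖f‖ * (2 * 0))) :=
      ((tendsto_pow_atTop_nhds_zero_of_lt_one (by norm_num) (by norm_num)).const_mul 2).const_mul _
    rw [mul_zero, mul_zero] at h1
    exact ((h1.eventually_lt_const (half_pos hε)).exists).imp fun _ h => h.le
  have h2 : ∀ n, ∀ᶠ k in atTop, |f (x n k)| < ε / (2 * (R + 1)) := fun n => by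
    simpa using Metric.tendsto_nhds.1 (hw n f) (ε / (2 * (R + 1))) (by positivity)
  obtain ⟨j, hj⟩ := eventually_atTop.1
    ((eventually_all_finset (Finset.range R)).2 fun n _ => h2 n)
  refine ⟨max j R, fun i hi1 hi2 => ?_⟩
  have hRi : R ≤ i.1 := (le_max_right _ _).trans hi1
  have h3 := (f.le_opNorm _).trans (mul_le_mul_of_nonneg_left
    (norm_weightedSum_sub_le hx hc0 hc hRi) (norm_nonneg f))
  rw [map_sub, Real.norm_eq_abs] at h3
  have h4 : |f (∑ n ∈ Finset.range R, c n • x n (tupleEntry n i))| ≤ ε / 2 := by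
    rw [map_sum]
    refine (Finset.abs_sum_le_sum_abs _ _).trans ?_
    have h5 : ∀ n ∈ Finset.range R, |f (c n • x n (tupleEntry n i))| ≤ ε / (2 * (R + 1)) := by
      intro n hn
      have hni : n < i.1 := (Finset.mem_range.1 hn).trans_le hRi
      rw [map_smul, smul_eq_mul, abs_mul, abs_of_pos (hc0 n)]
      have h6 : c n ≤ 1 := (hc n).trans (pow_le_one₀ (by norm_num) (by norm_num))
      have h7 := hj (tupleEntry n i) (by
        simp only [tupleEntry, hni, dif_pos]
        exact (le_max_left _ _).trans (hi2 _)) n hn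
      nlinarith [abs_nonneg (f (x n (tupleEntry n i))), hc0 n]
    refine (Finset.sum_le_card_nsmul _ _ _ h5).trans ?_
    rw [Finset.card_range, nsmul_eq_mul, ← mul_div_assoc, div_le_div_iff₀ (by positivity) two_pos]
    nlinarith
  have h8 := abs_le.1 (h3.trans hR)
  have h9 := abs_le.1 h4
  rw [abs_le]
  constructor <;> linarith [h8.1, h8.2, h9.1, h9.2]

/-- Since the indices of the different sequences are independent, the limit over the tuple is an
iterated limit along weakly null variables, one of which is the `m`-th; `le_iterLim_of_tendsto`
discards the others. -/
theorem tendsto_weightedSum_le (hx : ∀ n i, ‖x n i‖ = 1) (hw : ∀ n, IsWeaklyNull (x n)) (m : ℕ)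
    (F : X → ℝ) (hF : LipschitzWith 1 F) (hFc : ConvexOn ℝ Set.univ F) (t : ℝ) (v : X) (L L' : ℝ)
    (hL : Tendsto (fun k => F (v + t • c m • x m k)) (hyperfilter ℕ) (𝓝 L))
    (hL' : Tendsto (fun i => F (v + t • weightedSum x c i)) tupleUltrafilter (𝓝 L')) : L ≤ L' := by
  refine le_of_forall_lt fun b hb => ?_
  obtain ⟨b', hbb', hb'⟩ := exists_between hb
  refine hbb'.trans_le (ge_of_tendsto hL' ?_)
  rw [eventually_tupleUltrafilter]
  filter_upwards [Nat.hyperfilter_le_atTop (eventually_gt_atTop m)] with r hr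
  have hbd : ∀ n : Fin r, ∃ C, ∀ i, ‖t • c n • x n i‖ ≤ C := fun n =>
    ⟨|t| * |c n|, fun i => by simp [norm_smul, hx]⟩
  have hwn : ∀ n : Fin r, ∀ f : StrongDual ℝ X,
      Tendsto (fun i => f (t • c n • x n i)) (hyperfilter ℕ) (𝓝 0) := fun n f => by
    simpa using (((hw n f).mono_left Nat.hyperfilter_le_atTop).const_mul (c n)).const_mul t
  have h1 := le_iterLim_of_tendsto hF hFc hbd hwn ⟨m, hr⟩ hL
  filter_upwards [(tendsto_iterLim hF hbd v).eventually_const_lt (hb'.trans_le h1)] with k hk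
  simpa [weightedSum, Finset.smul_sum] using hk.le

/-- Countably many weakly null spreading models are dominated by one that is dominated by their
weighted sum. -/
theorem exists_weakSpreadingModel_weighted {N : ℕ → Seminorm ℝ (ℕ →₀ ℝ)}
    (hw : ∀ n, IsWeaklyNull (x n)) (hN : ∀ n, GeneratesSpreadingModel (x n) (N n))
    (hc0 : ∀ n, 0 < c n) (hc : ∀ n, c n ≤ (1 / 2) ^ n) :
    ∃ u : WeakSpreadingModel X, (∀ m, ∃ C, ∀ f, N m f ≤ C * u.1 f) ∧
      ∃ D, ∀ f B, (∀ r, ∑ n ∈ Finset.range r, c n * N n f ≤ B) → u.1 f ≤ D * B := by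
  have hx : ∀ n i, ‖x n i‖ = 1 := fun n => (hN n).1
  set V := tupleUltrafilter with hV
  set y := weightedSum x c with hy
  have hy2 : ∀ i, ‖y i‖ ≤ 2 := norm_weightedSum_le hx hc0 hc
  obtain ⟨l, hl⟩ := exists_tendsto_of_bounded V (f := fun i => ‖y i‖) (C := 2) fun i => by
    rw [abs_norm]
    exact hy2 i
  -- The weighted sums do not tend to zero in norm, so they can be normalized.
  have hl0 : c 0 ≤ l := by
    refine tendsto_weightedSum_le hx hw 0 norm lipschitzWith_one_norm convexOn_univ_norm 1 0 _ _
      ?_ (by simpa using hl)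
    simp [norm_smul, hx, abs_of_pos (hc0 0)]
  have hlpos : 0 < l := (hc0 0).trans_le hl0
  have hev : ∀ᶠ i in (V : Filter _), c 0 / 2 ≤ ‖y i‖ :=
    (hl.eventually_const_lt (by linarith [hc0 0] : c 0 / 2 < l)).mono fun i hi => hi.le
  have hyw : ∀ f : StrongDual ℝ X, Tendsto (fun i => f (y i)) V (𝓝 0) := fun f => by
    rw [Metric.tendsto_nhds]
    intro ε hε
    obtain ⟨j, hj⟩ := exists_forall_abs_weightedSum_le hx hc0 hc hw f (half_pos hε)
    filter_upwards [eventually_tupleUltrafilter_ge j] with i hi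
    rw [Real.dist_eq, sub_zero]
    exact (hj i hi.1 hi.2).trans_lt (half_lt_self hε)
  have hinv : Tendsto (fun i => ‖y i‖⁻¹) V (𝓝 l⁻¹) := hl.inv₀ hlpos.ne'
  let y' := fun i => ‖y i‖⁻¹ • y i
  have hy'1 : ∀ i, ‖y' i‖ ≤ 1 := fun i => by
    simp only [y', norm_smul, norm_inv, norm_norm]
    exact inv_mul_le_one
  have hy'e : ∀ i, c 0 / 2 ≤ ‖y i‖ → ‖y' i‖ = 1 := fun i hi => by
    simp only [y', norm_smul, norm_inv, norm_norm]
    exact inv_mul_cancel₀ (by linarith [hc0 0])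
  have hy'w : ∀ f : StrongDual ℝ X, Tendsto (fun i => f (y' i)) V (𝓝 0) := fun f => by
    simpa [y'] using hinv.mul (hyw f)
  -- Being weakly null along `V` does not pass to a sequence of indices chosen from `V`-large sets
  -- in general. The sets `A j` force lengths and entries to infinity and keep the norms away from
  -- zero.
  obtain ⟨s, M, hs, hM, hMl⟩ := exists_generatesSpreadingModel hy'1 (hev.mono hy'e) hy'w
    (A := fun j => {i | (j ≤ i.1 ∧ ∀ n, j ≤ i.2 n) ∧ c 0 / 2 ≤ ‖y i‖})
    (fun j => (eventually_tupleUltrafilter_ge j).and hev)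
  have hly : ∀ i, ‖l⁻¹ • y i‖ ≤ l⁻¹ * 2 := fun i => by
    rw [norm_smul, Real.norm_of_nonneg (by positivity)]
    have := hy2 i
    gcongr
  have hMl' : ∀ (n : ℕ) (a : Fin n → ℝ), M (∑ i : Fin n, Finsupp.single (i : ℕ) (a i))
      = iterLim V norm (fun j i => a j • l⁻¹ • y i) 0 := fun n a => by
    rw [hMl]
    refine iterLim_congr lipschitzWith_one_norm (exists_bound_smul hy'1 a)
      (fun j => exists_bound_const_smul hly (a j)) (fun j => ?_) 0
    have h1 : Tendsto (fun i => |a j| * (|‖y i‖⁻¹ - l⁻¹| * 2)) V (𝓝 0) := by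
      simpa using (((hinv.sub_const l⁻¹).abs).mul_const 2).const_mul |a j|
    refine squeeze_zero_norm (fun i => ?_) h1
    have e : a j • y' i - a j • l⁻¹ • y i = a j • (‖y i‖⁻¹ - l⁻¹) • y i := by
      rw [← smul_sub, sub_smul]
    rw [e, norm_smul, norm_smul, Real.norm_eq_abs, Real.norm_eq_abs]
    have := hy2 i
    gcongr
  refine ⟨⟨M, fun j => y' (s j), fun f => ?_, hM⟩, fun m => ⟨l / c m, fun f => ?_⟩, l⁻¹,
    fun f B hB => ?_⟩
  · rw [Metric.tendsto_atTop]
    intro ε hε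
    have hc00 := hc0 0
    obtain ⟨j, hj⟩ := exists_forall_abs_weightedSum_le hx hc0 hc hw f
      (ε := ε * (c 0 / 4)) (by positivity)
    refine ⟨j, fun n hn => ?_⟩
    have h1 := hj (s n) (hn.trans (hs n).1.1) fun i => hn.trans ((hs n).1.2 i)
    have h2 : c 0 / 2 ≤ ‖y (s n)‖ := (hs n).2
    simp only [y', Real.dist_eq, sub_zero, map_smul, smul_eq_mul, abs_mul, abs_inv, abs_norm]
    rw [inv_mul_lt_iff₀ (by linarith)]
    nlinarith
  · obtain ⟨n, a, rfl⟩ := exists_eq_sum_single f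
    rw [hMl', (hN m).eq_iterLim Nat.hyperfilter_le_atTop]
    have h1 := iterLim_le_iterLim (U := hyperfilter ℕ) (V := V)
      (z := fun k => (l⁻¹ * c m) • x m k) (y := fun i => l⁻¹ • y i) (C := |l⁻¹ * c m|)
      (fun i => by simp [norm_smul, hx]) hly
      (fun F hF hFc t v L L' hL hL' => tendsto_weightedSum_le (c := c) hx hw m F hF hFc (t * l⁻¹)
        v L L' (by simpa [mul_smul] using hL) (by simpa [mul_smul] using hL')) a 0
    have h2 : iterLim (hyperfilter ℕ) norm (fun j k => a j • (l⁻¹ * c m) • x m k) 0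
        = l⁻¹ * c m * iterLim (hyperfilter ℕ) norm (fun j k => a j • x m k) 0 := by
      have := hc0 m
      rw [← iterLim_norm_mul (fun i => (hx m i).le) (by positivity)]
      simp only [smul_smul, mul_comm]
    rw [h2, inv_mul_eq_div, div_mul_eq_mul_div, div_le_iff₀ hlpos] at h1
    rw [div_mul_eq_mul_div, le_div_iff₀ (hc0 m)]
    linarith
  · obtain ⟨n, a, rfl⟩ := exists_eq_sum_single f
    show M _ ≤ _
    rw [hMl']
    have hR : ∀ R : ℕ, iterLim V norm (fun j i => a j • l⁻¹ • y i) 0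
        ≤ l⁻¹ * (B + (∑ j, |a j|) * (2 * (1 / 2) ^ R)) := by
      intro R
      have h1 := tendsto_iterLim_norm_zero (U := V) fun j => exists_bound_const_smul hly (a j)
      -- The `m`-th entries run along a free ultrafilter on `ℕ`, so the `m`-th component contributes
      -- `c m * N m`; the remaining components cost at most the geometric tail.
      have h2 : Tendsto (fun k : Fin n → (Σ r : ℕ, Fin r → ℕ) => l⁻¹ *
          (∑ m ∈ Finset.range R, c m * ‖∑ j, a j • x m (tupleEntry m (k j))‖
            + (∑ j, |a j|) * (2 * (1 / 2) ^ R))) (iterPow V n)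
          (𝓝 (l⁻¹ * (∑ m ∈ Finset.range R,
            c m * N m (∑ i : Fin n, Finsupp.single (i : ℕ) (a i))
            + (∑ j, |a j|) * (2 * (1 / 2) ^ R)))) :=
        ((tendsto_finsetSum _ fun m _ => (((hN m).tendsto (map_tupleEntry_le_atTop m) a).comp
          (tendsto_iterPow_map V (tupleEntry m) n)).const_mul (c m)).add_const _).const_mul _
      refine (le_of_tendsto_of_tendsto h1 h2 ?_).trans
        (mul_le_mul_of_nonneg_left (by linarith [hB R]) (by positivity))
      filter_upwards [eventually_all.2 fun j : Fin n =>
        eventually_iterPow_eval j (eventually_tupleUltrafilter_ge R)] with k hk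
      have e1 : ∑ j, a j • l⁻¹ • y (k j) = l⁻¹ • (∑ m ∈ Finset.range R,
          c m • ∑ j, a j • x m (tupleEntry m (k j)) + ∑ j, a j • (y (k j)
            - ∑ m ∈ Finset.range R, c m • x m (tupleEntry m (k j)))) := by
        have e2 : ∑ m ∈ Finset.range R, c m • ∑ j, a j • x m (tupleEntry m (k j))
            = ∑ j, a j • ∑ m ∈ Finset.range R, c m • x m (tupleEntry m (k j)) := by
          simp only [Finset.smul_sum]
          rw [Finset.sum_comm]
          exact Finset.sum_congr rfl fun j _ => Finset.sum_congr rfl fun m _ => smul_comm _ _ _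
        rw [e2, ← Finset.sum_add_distrib, Finset.smul_sum]
        refine Finset.sum_congr rfl fun j _ => ?_
        rw [← smul_add, add_sub_cancel, smul_comm]
      rw [e1, norm_smul, Real.norm_of_nonneg (by positivity)]
      gcongr
      refine (norm_add_le _ _).trans (add_le_add ?_ ?_)
      · refine norm_sum_le_of_le _ fun m _ => ?_
        rw [norm_smul, Real.norm_of_nonneg (hc0 m).le]
      · rw [Finset.sum_mul]
        refine norm_sum_le_of_le _ fun j _ => ?_
        rw [norm_smul, Real.norm_eq_abs]
        have := norm_weightedSum_sub_le hx hc0 hc (hk j).1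
        gcongr
    have h3 : Tendsto (fun R : ℕ => l⁻¹ * (B + (∑ j, |a j|) * (2 * (1 / 2 : ℝ) ^ R))) atTop
        (𝓝 (l⁻¹ * (B + (∑ j, |a j|) * (2 * 0)))) :=
      ((((tendsto_pow_atTop_nhds_zero_of_lt_one (by norm_num) (by norm_num)).const_mul
        2).const_mul _).const_add _).const_mul _
    simpa using ge_of_tendsto' h3 hR

end weightedSum

/-! ### Countable sets of spreading models: part (1). -/

section chains

variable {X : Type*} [NormedAddCommGroup X] [NormedSpace ℝ X]

/-- Positive weights that make a weighted sum of seminorms small, compared with `T k`, at the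
vector `a k`. -/
theorem exists_weights (N T : ℕ → Seminorm ℝ (ℕ →₀ ℝ)) (a : ℕ → ℕ →₀ ℝ) :
    ∃ c : ℕ → ℝ, (∀ n, 0 < c n) ∧ (∀ n, c n ≤ (1 / 2) ^ n) ∧
      ∀ k, (k + 1) * ∑ n ∈ Finset.range (k + 1), N n (a k) < T k (a k) →
        ∀ r, ∑ n ∈ Finset.range r, c n * N n (a k) ≤ 3 * T k (a k) / (k + 1) := by
  -- The `n`-th weight meets the demands of all `k < n`, finitely many, through a product of factors
  -- at most `1`; the `1 +` keeps the denominator positive. For given `k`, the terms with `n ≤ k`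
  -- are controlled by the hypothesis and contribute at most `T k (a k) / (k + 1)`, the later ones
  -- at most twice that, whence the `3`.
  let q : ℕ → ℕ → ℝ := fun n k =>
    if 0 < T k (a k) then min 1 (T k (a k) / ((k + 1) * (1 + N n (a k)))) else 1
  have hN0 : ∀ n k, 0 ≤ N n (a k) := fun n k => apply_nonneg _ _
  have hq0 : ∀ n k, 0 < q n k := fun n k => by
    have := hN0 n k
    simp only [q]
    split_ifs with h
    · exact lt_min one_pos (by positivity)
    · exact one_pos
  have hq1 : ∀ n k, q n k ≤ 1 := fun n k => by
    simp only [q]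
    split_ifs with h
    · exact min_le_left _ _
    · exact le_rfl
  have hP1 : ∀ n (s : Finset ℕ), ∏ k ∈ s, q n k ≤ 1 := fun n s =>
    Finset.prod_le_one (fun k _ => (hq0 n k).le) fun k _ => hq1 n k
  have hpow : ∀ n : ℕ, (0 : ℝ) < (1 / 2) ^ n := fun n => by positivity
  refine ⟨fun n => (1 / 2) ^ n * ∏ k ∈ Finset.range n, q n k,
    fun n => mul_pos (hpow n) (Finset.prod_pos fun k _ => hq0 n k),
    fun n => mul_le_of_le_one_right (hpow n).le (hP1 n _), fun k hk r => ?_⟩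
  have hT : 0 < T k (a k) :=
    lt_of_le_of_lt (mul_nonneg (by positivity) (Finset.sum_nonneg fun n _ => hN0 n k)) hk
  have hterm : ∀ n ∈ Finset.range r, ((1 / 2) ^ n * ∏ k ∈ Finset.range n, q n k) * N n (a k)
      ≤ (if n ∈ Finset.range (k + 1) then N n (a k) else 0)
        + (1 / 2) ^ n * (T k (a k) / (k + 1)) := by
    intro n _
    split_ifs with hn
    · have h1 : ((1 / 2) ^ n * ∏ k ∈ Finset.range n, q n k) * N n (a k) ≤ 1 * N n (a k) := by
        refine mul_le_mul_of_nonneg_right ?_ (hN0 n k)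
        exact mul_le_one₀ (pow_le_one₀ (by norm_num) (by norm_num))
          (Finset.prod_nonneg fun k _ => (hq0 n k).le) (hP1 n _)
      have h2 : 0 ≤ (1 / 2 : ℝ) ^ n * (T k (a k) / (k + 1)) := by positivity
      linarith
    · have hkn : k ∈ Finset.range n := by
        rw [Finset.mem_range] at hn ⊢
        omega
      rw [zero_add, mul_assoc]
      refine mul_le_mul_of_nonneg_left ?_ (hpow n).le
      have h1 : ∏ k ∈ Finset.range n, q n k ≤ q n k := by
        rw [← Finset.mul_prod_erase _ _ hkn]
        exact mul_le_of_le_one_right (hq0 n k).le (hP1 n _)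
      have h2 : q n k ≤ T k (a k) / ((k + 1) * (1 + N n (a k))) := by
        simp only [q, if_pos hT]
        exact min_le_right _ _
      have h0 := hN0 n k
      calc (∏ k ∈ Finset.range n, q n k) * N n (a k)
          ≤ T k (a k) / ((k + 1) * (1 + N n (a k))) * (1 + N n (a k)) := by
            refine mul_le_mul (h1.trans h2) (by linarith) h0 (by positivity)
        _ = T k (a k) / (k + 1) := by field_simp
  refine (Finset.sum_le_sum hterm).trans ?_
  rw [Finset.sum_add_distrib, ← Finset.sum_mul, ← Finset.sum_filter]
  have h1 : ∑ n ∈ Finset.range r with n ∈ Finset.range (k + 1), N n (a k)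
      ≤ ∑ n ∈ Finset.range (k + 1), N n (a k) :=
    Finset.sum_le_sum_of_subset_of_nonneg (fun n hn => (Finset.mem_filter.1 hn).2)
      fun n _ _ => hN0 n k
  have h2 : ∑ n ∈ Finset.range (k + 1), N n (a k) ≤ T k (a k) / (k + 1) := by
    rw [le_div_iff₀' (by positivity)]
    exact hk.le
  have h3 : ∑ n ∈ Finset.range r, (1 / 2 : ℝ) ^ n ≤ 2 := by
    rw [Finset.range_eq_Ico]
    refine (geom_sum_Ico_le_of_lt_one (by norm_num) (by norm_num)).trans (le_of_eq ?_)
    norm_num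
  have h4 : 0 ≤ T k (a k) / (k + 1) := by positivity
  rw [mul_div_assoc]
  nlinarith

/-- A countable set of weakly null spreading models contains no strictly increasing sequence. -/
theorem wellFoundedGT_SPw [Countable (SPw X)] : WellFoundedGT (SPw X) := by
  refine ⟨RelEmbedding.wellFounded_iff_isEmpty.2 ⟨fun φ => ?_⟩⟩
  let s : ℕ → SPw X := fun n => φ n
  have hsm : ∀ i j, i < j → s i < s j := fun i j hij => φ.map_rel_iff.2 hij
  let M : SPw X → WeakSpreadingModel X := ofAntisymmetrization (· ≤ ·)
  have hM : ∀ {p q : SPw X}, M p ≤ M q ↔ p ≤ q := fun {p q} =>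
    ofAntisymmetrization_le_ofAntisymmetrization_iff
  choose x hxw hx using fun n => (M (s n)).2
  have : Nonempty (SPw X) := ⟨s 0⟩
  obtain ⟨e, he⟩ := exists_surjective_nat (SPw X)
  have ha : ∀ k : ℕ, ∃ a : ℕ →₀ ℝ, (∀ n, s n ≤ e (Nat.unpair k).1) →
      (k + 1) * ∑ n ∈ Finset.range (k + 1), (M (s n)).1 a < (M (e (Nat.unpair k).1)).1 a := by
    intro k
    by_cases hk : ∀ n, s n ≤ e (Nat.unpair k).1
    · by_contra! hcon
      have hD : ∀ n ∈ Finset.range (k + 1), ∃ D : ℝ, ∀ a, (M (s n)).1 a ≤ D * (M (s k)).1 a :=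
        fun n hn => hM.2 (by
          rcases (Nat.lt_succ_iff.1 (Finset.mem_range.1 hn)).eq_or_lt with h | h
          · rw [h]
          · exact (hsm _ _ h).le)
      choose! D hD using hD
      have : M (e (Nat.unpair k).1) ≤ M (s k) :=
        ⟨(k + 1) * ∑ n ∈ Finset.range (k + 1), D n, fun a => by
          refine (hcon a).2.trans ?_
          rw [mul_assoc, Finset.sum_mul]
          gcongr with n hn
          exact hD n hn a⟩
      exact absurd ((hk (k + 1)).trans (hM.1 this)) (hsm k (k + 1) k.lt_succ_self).not_ge
    · exact ⟨0, fun h => absurd h hk⟩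
  choose a ha using ha
  obtain ⟨c, hc0, hc1, hc⟩ := exists_weights (fun n => (M (s n)).1)
    (fun k => (M (e (Nat.unpair k).1)).1) a
  obtain ⟨u, hu, D, hD⟩ := exists_weakSpreadingModel_weighted hxw hx hc0 hc1
  obtain ⟨m, hm⟩ := he (toAntisymmetrization (· ≤ ·) u)
  have hsu : ∀ n, s n ≤ e m := fun n => by
    rw [hm, ← toAntisymmetrization_ofAntisymmetrization (· ≤ ·) (s n)]
    exact toAntisymmetrization_le_toAntisymmetrization_iff.2 (hu n)
  have hTu : M (e m) ≤ u := by
    rw [← toAntisymmetrization_le_toAntisymmetrization_iff, ← hm]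
    exact (toAntisymmetrization_ofAntisymmetrization (· ≤ ·) (e m)).le
  obtain ⟨B, hB⟩ := hTu
  -- At the vector attached to `k = Nat.pair m p`, the model `u` is at most a multiple of `1 / (k +
  -- 1)` of its own representative `M (e m)`. A large `p` beats the constants `B` and `D`.
  obtain ⟨p, hp⟩ := exists_nat_gt (|B| * (|D| * 3))
  set k := Nat.pair m p with hk
  have hkm : (Nat.unpair k).1 = m := by rw [hk, Nat.unpair_pair]
  have h1 := ha k (by rw [hkm]; exact hsu)
  have h2 := hD (a k) _ (hc k h1)
  have hT : 0 < (M (e (Nat.unpair k).1)).1 (a k) :=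
    lt_of_le_of_lt (mul_nonneg (by positivity) (Finset.sum_nonneg fun n _ => apply_nonneg _ _)) h1
  rw [hkm] at h2 hT
  set t := (M (e m)).1 (a k)
  have hpk : (p : ℝ) ≤ k := by exact_mod_cast Nat.right_le_pair m p
  have h3 : t ≤ |B| * (|D| * (3 * t / (k + 1))) := by
    refine (hB (a k)).trans ?_
    refine (mul_le_mul_of_nonneg_right (le_abs_self B) (apply_nonneg _ _)).trans ?_
    refine mul_le_mul_of_nonneg_left (h2.trans ?_) (abs_nonneg _)
    exact mul_le_mul_of_nonneg_right (le_abs_self D) (by positivity)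
  have h4 : |B| * (|D| * (3 * t / (k + 1))) = |B| * (|D| * 3) / (k + 1) * t := by
    field_simp
  have h5 : |B| * (|D| * 3) / (k + 1) < 1 := by
    rw [div_lt_one (by positivity)]
    linarith
  rw [h4] at h3
  nlinarith

/-- Without strictly increasing sequences the relation `>` is a well-order, and `α` is its order
type. -/
theorem exists_ordinal_orderIso_SPw [Countable (SPw X)] (h : ∀ s t : SPw X, s ≤ t ∨ t ≤ s) :
    ∃ α : Ordinal.{0}, α.card ≤ Cardinal.aleph0 ∧ Nonempty (SPw X ≃o (α.ToType)ᵒᵈ) := by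
  classical
  let _ : LinearOrder (SPw X) :=
    { (inferInstance : PartialOrder (SPw X)) with
      le_total := h
      toDecidableLE := Classical.decRel _ }
  have hwf : WellFoundedGT (SPw X) := wellFoundedGT_SPw
  have hwo : IsWellOrder (SPw X) (· > ·) := { }
  refine ⟨Ordinal.type (α := SPw X) (· > ·), ?_, ?_⟩
  · rw [Ordinal.card_type]
    exact Cardinal.mk_le_aleph0
  · obtain ⟨φ⟩ := Ordinal.type_eq.1 (Ordinal.type_toType (Ordinal.type (α := SPw X) (· > ·)))
    have hmono : StrictMono fun s : SPw X => OrderDual.toDual (φ.symm s) := fun s t hst =>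
      OrderDual.toDual_lt_toDual.2 (φ.symm.map_rel_iff.2 hst)
    exact ⟨hmono.orderIsoOfSurjective _ (OrderDual.toDual.surjective.comp φ.symm.surjective)⟩

end chains

/-! ### Sums of Banach spaces -/

section lpSum

open scoped ENNReal

variable {α : Type*} {E : α → Type*} [∀ i, NormedAddCommGroup (E i)] {p : ℝ≥0∞}

section

variable [DecidableEq α]

theorem sub_sum_single_apply_of_mem (f : lp E p) {s : Finset α} {i : α} (hi : i ∈ s) :
    (f - ∑ i ∈ s, lp.single p i (f i)) i = 0 := by
  simp only [lp.coeFn_sub, lp.coeFn_sum, Pi.sub_apply, Finset.sum_apply, lp.coeFn_single,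
    Finset.sum_pi_single, if_pos hi, sub_self]

theorem sum_single_apply_of_notMem (f : lp E p) {s : Finset α} {i : α} (hi : i ∉ s) :
    (∑ i ∈ s, lp.single p i (f i)) i = 0 := by
  simp only [lp.coeFn_sum, Finset.sum_apply, lp.coeFn_single, Finset.sum_pi_single, if_neg hi]

end

variable [hp1 : Fact (1 ≤ p)]

theorem toReal_pos_of_ne_top (hp : p ≠ ∞) : 0 < p.toReal :=
  ENNReal.toReal_pos (zero_lt_one.trans_le hp1.out).ne' hp

theorem norm_add_rpow_of_disjoint (hp : p ≠ ∞) {v w : lp E p} (h : ∀ i, v i = 0 ∨ w i = 0) :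
    ‖v + w‖ ^ p.toReal = ‖v‖ ^ p.toReal + ‖w‖ ^ p.toReal := by
  have hp0 := toReal_pos_of_ne_top hp
  refine (lp.hasSum_norm hp0 (v + w)).unique ?_
  refine ((lp.hasSum_norm hp0 v).add (lp.hasSum_norm hp0 w)).congr_fun fun i => ?_
  rw [lp.coeFn_add, Pi.add_apply]
  rcases h i with h | h <;> simp [h, Real.zero_rpow hp0.ne']

/-- Testing `Φ` on `G = ∑ ‖x i‖ ^ (r - 1) • g i`, with `g i` norming `x i`, yields the partial sum
`A` of `‖x i‖ ^ r`. By Hölder `‖G‖ ≤ A ^ (1 / q)`, so `A ^ (1 / r) ≤ ‖Φ‖`. -/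
theorem exists_lp_of_bidual [∀ i, NormedSpace ℝ (E i)] (h1 : 1 < p) (hp : p ≠ ∞)
    (Φ : StrongDual ℝ (StrongDual ℝ (lp E p))) {x : ∀ i, E i}
    (hx : ∀ i (g : StrongDual ℝ (E i)), Φ (g.comp (lp.evalCLM ℝ E p i)) = g (x i)) :
    Memℓp x p := by
  have hp0 := toReal_pos_of_ne_top hp
  have hp1' : 1 < p.toReal := by
    rw [← ENNReal.toReal_one]
    exact (ENNReal.toReal_lt_toReal ENNReal.one_ne_top hp).2 h1
  refine memℓp_gen' (C := ‖Φ‖ ^ p.toReal) fun S => ?_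
  have hpq := Real.HolderConjugate.conjExponent hp1'
  set r := p.toReal with hr
  set q := Real.conjExponent r with hq
  choose g hg1 hgx using fun i => exists_dual_vector'' ℝ (x i)
  set A := ∑ i ∈ S, ‖x i‖ ^ r with hA
  have hA0 : 0 ≤ A := by positivity
  let G : StrongDual ℝ (lp E p) :=
    ∑ i ∈ S, (‖x i‖ ^ (r - 1)) • (g i).comp (lp.evalCLM ℝ E p i)
  have hΦG : Φ G = A := by
    simp only [G, map_sum, map_smul, hx, hgx, smul_eq_mul, A]
    refine Finset.sum_congr rfl fun i _ => ?_
    rcases eq_or_ne (x i) 0 with h | h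
    · simp [h, Real.zero_rpow hp0.ne']
    · have : 0 < ‖x i‖ := norm_pos_iff.2 h
      nth_rewrite 3 [← Real.rpow_one ‖x i‖]
      simp only [RCLike.ofReal_real_eq_id, id]
      rw [Real.rpow_one]
      nth_rewrite 2 [← Real.rpow_one ‖x i‖]
      rw [← Real.rpow_add this, sub_add_cancel]
  have hG : ‖G‖ ≤ A ^ (1 / q) := by
    refine G.opNorm_le_bound (by positivity) fun v => ?_
    have h2 : ‖G v‖ ≤ ∑ i ∈ S, ‖x i‖ ^ (r - 1) * ‖v i‖ := by
      simp only [G, sum_apply, smul_apply]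
      refine norm_sum_le_of_le _ fun i _ => ?_
      rw [norm_smul, Real.norm_of_nonneg (by positivity)]
      refine mul_le_mul_of_nonneg_left ?_ (by positivity)
      exact ((g i).le_of_opNorm_le (hg1 i) (v i)).trans (by rw [one_mul])
    have h3 := Real.inner_le_Lp_mul_Lq S (fun i => ‖x i‖ ^ (r - 1)) (fun i => ‖v i‖) hpq.symm
    have h4 : ∑ i ∈ S, |‖x i‖ ^ (r - 1)| ^ q = A := by
      refine Finset.sum_congr rfl fun i _ => ?_
      rw [abs_of_nonneg (by positivity), ← Real.rpow_mul (norm_nonneg _), hpq.sub_one_mul_conj]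
    have h5 : (∑ i ∈ S, |‖v i‖| ^ r) ^ (1 / r) ≤ ‖v‖ := by
      have := lp.sum_rpow_le_norm_rpow hp0 v S
      simp only [abs_norm]
      calc (∑ i ∈ S, ‖v i‖ ^ r) ^ (1 / r) ≤ (‖v‖ ^ r) ^ (1 / r) := by gcongr
        _ = ‖v‖ := by rw [one_div, Real.rpow_rpow_inv (norm_nonneg _) hp0.ne']
    rw [h4] at h3
    exact h2.trans (h3.trans (by gcongr))
  have h6 : A ≤ ‖Φ‖ * A ^ (1 / q) := by
    calc A = Φ G := hΦG.symm
      _ ≤ ‖Φ G‖ := le_abs_self _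
      _ ≤ ‖Φ‖ * ‖G‖ := Φ.le_opNorm _
      _ ≤ ‖Φ‖ * A ^ (1 / q) := by gcongr
  rcases hA0.eq_or_lt with h7 | h7
  · rw [← h7]
    positivity
  · have h8 : A ^ (1 / r) ≤ ‖Φ‖ := by
      have h9 : A = A ^ (1 / r) * A ^ (1 / q) := by
        rw [← Real.rpow_add h7, one_div, one_div, hpq.inv_add_inv_eq_one, Real.rpow_one]
      exact le_of_mul_le_mul_right (h9.symm.le.trans h6) (by positivity)
    calc A = (A ^ (1 / r)) ^ r := by
          rw [one_div, Real.rpow_inv_rpow hA0 hp0.ne']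
      _ ≤ ‖Φ‖ ^ r := by gcongr

variable [DecidableEq α]

theorem norm_sub_sum_single_le (hp : p ≠ ∞) (f : lp E p) (s : Finset α) :
    ‖f - ∑ i ∈ s, lp.single p i (f i)‖ ≤ ‖f‖ := by
  have hp0 := toReal_pos_of_ne_top hp
  rw [← Real.rpow_le_rpow_iff (norm_nonneg _) (norm_nonneg _) hp0,
    lp.norm_compl_sum_single hp0]
  have : 0 ≤ ∑ i ∈ s, ‖f i‖ ^ p.toReal := by positivity
  linarith

variable [∀ i, NormedSpace ℝ (E i)]

/-- A functional on an `ℓ_p`-sum, `1 < p < ∞`, is small on vectors that vanish on a suitable finite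
set of coordinates. -/
theorem exists_finset_abs_le (h1 : 1 < p) (hp : p ≠ ∞) (f : StrongDual ℝ (lp E p)) {ε : ℝ}
    (hε : 0 < ε) : ∃ S : Finset α, ∀ v : lp E p, (∀ i ∈ S, v i = 0) → |f v| ≤ ε * ‖v‖ := by
  have hp0 := toReal_pos_of_ne_top hp
  by_contra! hcon
  -- If the claim fails, there are finitely supported unit vectors off any finite set on which `f`
  -- exceeds `ε`. Then `n` disjoint ones have a sum of norm `n ^ (1 / p)` on which `f` is at least
  -- `n * ε`, impossible for large `n` because `p > 1`.
  have hblock : ∀ S : Finset α, ∃ u : lp E p × Finset α, (∀ i, i ∉ u.2 → u.1 i = 0) ∧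
      (∀ i ∈ S, u.1 i = 0) ∧ ‖u.1‖ = 1 ∧ ε < f u.1 := by
    intro S
    obtain ⟨v, hvS, hv⟩ := hcon S
    have hs := lp.hasSum_single hp v
    have hev : ∀ᶠ T : Finset α in atTop, ε * ‖∑ i ∈ T, lp.single p i (v i)‖
        < |f (∑ i ∈ T, lp.single p i (v i))| :=
      (hs.norm.const_mul ε).eventually_lt ((f.continuous.tendsto _).comp hs).abs hv
    obtain ⟨T, hT⟩ := hev.exists
    set w := ∑ i ∈ T, lp.single p i (v i) with hw
    have hwT : ∀ i, i ∉ T → w i = 0 := fun i hi => sum_single_apply_of_notMem v hi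
    have hwS : ∀ i ∈ S, w i = 0 := fun i hi => by
      simp only [hw, lp.coeFn_sum, Finset.sum_apply, lp.coeFn_single, Finset.sum_pi_single,
        hvS i hi, ite_self]
    have hw0 : w ≠ 0 := fun h0 => by simp [h0] at hT
    have hpos : 0 < ‖w‖ := norm_pos_iff.2 hw0
    obtain ⟨σ, hσ, hσw⟩ : ∃ σ : ℝ, |σ| = 1 ∧ σ * f w = |f w| := by
      rcases abs_cases (f w) with h | h
      · exact ⟨1, by simp, by simp [h.1]⟩
      · exact ⟨-1, by simp, by simp [h.1]⟩
    refine ⟨((σ * ‖w‖⁻¹) • w, T), fun i hi => ?_, fun i hi => ?_, ?_, ?_⟩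
    · simp [hwT i hi]
    · simp [hwS i hi]
    · dsimp only
      rw [norm_smul, Real.norm_eq_abs, abs_mul, hσ, one_mul, abs_inv, abs_norm,
        inv_mul_cancel₀ hpos.ne']
    · dsimp only
      rw [map_smul, smul_eq_mul, mul_right_comm, hσw, ← div_eq_mul_inv, lt_div_iff₀ hpos]
      exact hT
  obtain ⟨s, hs⟩ := exists_seq_of_forall_history
    (Q := fun j g (u : lp E p × Finset α) => (∀ i, i ∉ u.2 → u.1 i = 0) ∧
      (∀ i ∈ Finset.univ.biUnion fun l : Fin j => (g l).2, u.1 i = 0) ∧ ‖u.1‖ = 1 ∧ ε < f u.1)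
    fun j g => hblock _
  have hnorm : ∀ n : ℕ, ‖∑ l ∈ Finset.range n, (s l).1‖ ^ p.toReal = n := by
    intro n
    induction n with
    | zero => simp [Real.zero_rpow hp0.ne']
    | succ n ih =>
      rw [Finset.sum_range_succ, norm_add_rpow_of_disjoint hp, ih, (hs n).2.2.1]
      · simp
      · intro i
        by_cases hi : ∃ l < n, i ∈ (s l).2
        · obtain ⟨l, hl, hil⟩ := hi
          exact Or.inr ((hs n).2.1 i (Finset.mem_biUnion.2 ⟨⟨l, hl⟩, Finset.mem_univ _, hil⟩))
        · push Not at hi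
          left
          rw [lp.coeFn_sum, Finset.sum_apply]
          exact Finset.sum_eq_zero fun l hl => (hs l).1 i (hi l (Finset.mem_range.1 hl))
  have hlow : ∀ n : ℕ, n * ε ≤ ‖f‖ * (n : ℝ) ^ (p.toReal⁻¹) := by
    intro n
    have h2 : (n : ℝ) * ε ≤ f (∑ l ∈ Finset.range n, (s l).1) := by
      rw [map_sum]
      have := Finset.card_nsmul_le_sum (Finset.range n) (fun l => f (s l).1) ε
        fun l _ => (hs l).2.2.2.le
      simpa using this
    refine h2.trans ((le_abs_self _).trans ((f.le_opNorm _).trans (le_of_eq ?_)))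
    rw [← hnorm n, Real.rpow_rpow_inv (norm_nonneg _) hp0.ne']
  have hexp : 0 < 1 - p.toReal⁻¹ := by
    have : 1 < p.toReal := by
      rw [← ENNReal.toReal_one]
      exact (ENNReal.toReal_lt_toReal ENNReal.one_ne_top hp).2 h1
    linarith [inv_lt_one_of_one_lt₀ this]
  have htend : Tendsto (fun n : ℕ => (n : ℝ) ^ (1 - p.toReal⁻¹)) atTop atTop :=
    (tendsto_rpow_atTop hexp).comp tendsto_natCast_atTop_atTop
  obtain ⟨n, hn, hn0⟩ := ((htend.eventually_gt_atTop (‖f‖ / ε)).and (eventually_gt_atTop 0)).exists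
  have hn0' : (0 : ℝ) < n := by exact_mod_cast hn0
  have h3 := hlow n
  rw [div_lt_iff₀ hε] at hn
  have h4 : (n : ℝ) ^ (1 - p.toReal⁻¹) * (n : ℝ) ^ (p.toReal⁻¹) = n := by
    rw [← Real.rpow_add hn0', sub_add_cancel, Real.rpow_one]
  have h5 : (0 : ℝ) < (n : ℝ) ^ (p.toReal⁻¹) := Real.rpow_pos_of_pos hn0' _
  nlinarith

/-- An `ℓ_p`-sum, `1 < p < ∞`, of reflexive spaces is reflexive. -/
theorem isReflexiveSpace_lp (h1 : 1 < p) (hp : p ≠ ∞) (hE : ∀ i, IsReflexiveSpace (E i)) :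
    IsReflexiveSpace (lp E p) := by
  intro Φ
  have hcoord : ∀ i, ∃ x : E i, ∀ g : StrongDual ℝ (E i),
      Φ (g.comp (lp.evalCLM ℝ E p i)) = g x := by
    intro i
    obtain ⟨x, hx⟩ := hE i
      (Φ.comp ((ContinuousLinearMap.compL ℝ (lp E p) (E i) ℝ).flip (lp.evalCLM ℝ E p i)))
    refine ⟨x, fun g => ?_⟩
    have := DFunLike.congr_fun hx g
    simpa using this.symm
  choose x hx using hcoord
  set X : lp E p := ⟨x, exists_lp_of_bidual h1 hp Φ hx⟩ with hX
  refine ⟨X, ContinuousLinearMap.ext fun f => ?_⟩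
  rw [NormedSpace.dual_def]
  refine eq_of_forall_dist_le fun ε hε => ?_
  obtain ⟨S, hS⟩ := exists_finset_abs_le h1 hp f (ε := ε / (‖Φ‖ + ‖X‖ + 1)) (by positivity)
  set η := ε / (‖Φ‖ + ‖X‖ + 1) with hη
  let P : lp E p →L[ℝ] lp E p :=
    ∑ i ∈ S, (lp.singleContinuousLinearMap ℝ E p i).comp (lp.evalCLM ℝ E p i)
  have hP : ∀ v, P v = ∑ i ∈ S, lp.single p i (v i) := fun v => by
    simp only [P, sum_apply]
    rfl
  have hfP : ∀ v, |f v - f (P v)| ≤ η * ‖v‖ := fun v => by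
    rw [← map_sub, hP]
    refine (hS _ fun i hi => sub_sum_single_apply_of_mem v hi).trans ?_
    have := norm_sub_sum_single_le hp v S
    gcongr
  -- `Φ` and evaluation at `X` agree on functionals of finitely many coordinates, and `f.comp P` is
  -- such a functional within `η` of `f` in norm.
  have h2 : Φ (f.comp P) = f (P X) := by
    have e : f.comp P = ∑ i ∈ S,
        (f.comp (lp.singleContinuousLinearMap ℝ E p i)).comp (lp.evalCLM ℝ E p i) := by
      ext v
      simp [P, map_sum]
    rw [e, map_sum, hP, map_sum]
    exact Finset.sum_congr rfl fun i _ => hx i _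
  have h3 : ‖f - f.comp P‖ ≤ η :=
    ContinuousLinearMap.opNorm_le_bound _ (by positivity) fun v => by
      simpa using hfP v
  have h4 : |Φ f - Φ (f.comp P)| ≤ ‖Φ‖ * η := by
    rw [← map_sub]
    exact (Φ.le_opNorm _).trans (by gcongr)
  have h5 := hfP X
  have h6 : η * (‖Φ‖ + ‖X‖ + 1) = ε := div_mul_cancel₀ _ (by positivity)
  have h7 : 0 < η := by positivity
  rw [h2] at h4
  rw [Real.dist_eq]
  have h8 := abs_le.1 h4
  have h9 := abs_le.1 h5
  rw [abs_le]
  constructor <;> nlinarith [h8.1, h8.2, h9.1, h9.2]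

theorem separableSpace_lp [Countable α] [∀ i, TopologicalSpace.SeparableSpace (E i)]
    (hp : p ≠ ∞) : TopologicalSpace.SeparableSpace (lp E p) := by
  have h1 : TopologicalSpace.IsSeparable (⋃ i, Set.range (lp.single (E := E) p i)) :=
    TopologicalSpace.IsSeparable.iUnion fun i =>
      TopologicalSpace.isSeparable_range (lp.isometry_single i).continuous
  have h2 := (h1.span (R := ℝ)).closure
  refine TopologicalSpace.isSeparable_univ_iff.1 (h2.mono fun f _ => ?_)
  exact mem_closure_of_tendsto (lp.hasSum_single hp f) (Eventually.of_forall fun S =>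
    Submodule.sum_mem _ fun i _ => Submodule.subset_span (Set.mem_iUnion.2 ⟨i, ⟨_, rfl⟩⟩))

end lpSum

theorem isReflexiveSpace_real : IsReflexiveSpace ℝ := fun Φ => by
  refine ⟨Φ (ContinuousLinearMap.id ℝ ℝ), ContinuousLinearMap.ext fun f => ?_⟩
  have : f = f 1 • ContinuousLinearMap.id ℝ ℝ := ContinuousLinearMap.ext_ring (by simp)
  rw [NormedSpace.dual_def]
  nth_rewrite 2 [this]
  rw [map_smul]
  nth_rewrite 1 [this]
  simp

/-! ### Limits of norms in sums of sequence spaces -/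

section limits

open scoped ENNReal

theorem norm_add_rpow_of_support {α : Type*} {E : α → Type*} [∀ i, NormedAddCommGroup (E i)]
    {p : ℝ≥0∞} [Fact (1 ≤ p)] (hp : p ≠ ∞) {v : lp E p} {S : Finset α}
    (hv : ∀ i, i ∉ S → v i = 0) (z : lp E p) :
    ‖v + z‖ ^ p.toReal = ∑ i ∈ S, ‖v i + z i‖ ^ p.toReal
      + (‖z‖ ^ p.toReal - ∑ i ∈ S, ‖z i‖ ^ p.toReal) := by
  classical
  have hp0 := toReal_pos_of_ne_top hp
  have h1 := lp.norm_compl_sum_single hp0 (v + z) S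
  have h2 := lp.norm_compl_sum_single hp0 z S
  have e : v + z - ∑ i ∈ S, lp.single p i ((v + z) i) = z - ∑ i ∈ S, lp.single p i (z i) := by
    ext i
    by_cases hi : i ∈ S
    · rw [sub_sum_single_apply_of_mem _ hi, sub_sum_single_apply_of_mem _ hi]
    · rw [lp.coeFn_sub, Pi.sub_apply, sum_single_apply_of_notMem _ hi, lp.coeFn_sub, Pi.sub_apply,
        sum_single_apply_of_notMem _ hi, lp.coeFn_add, Pi.add_apply, hv i hi, zero_add]
  rw [e, h2] at h1
  simp only [lp.coeFn_add, Pi.add_apply] at h1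
  linarith

/-- Reduces limit formulas for norms to finitely supported vectors, where coordinatewise convergence
is enough. -/
theorem tendsto_of_lipschitz_of_tendsto {I J X : Type*} [PseudoMetricSpace X] {U : Filter I}
    {l : Filter J} [l.NeBot] {g : I → X → ℝ} (hg : ∀ i, LipschitzWith 1 (g i)) {h : X → ℝ}
    {w : J → X} {v : X} (hw : Tendsto w l (𝓝 v)) (hh : Tendsto (fun j => h (w j)) l (𝓝 (h v)))
    (H : ∀ j, Tendsto (fun i => g i (w j)) U (𝓝 (h (w j)))) :
    Tendsto (fun i => g i v) U (𝓝 (h v)) := by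
  rw [Metric.tendsto_nhds]
  intro ε hε
  obtain ⟨j, hj1, hj2⟩ := ((Metric.tendsto_nhds.1 hw (ε / 3) (by positivity)).and
    (Metric.tendsto_nhds.1 hh (ε / 3) (by positivity))).exists
  filter_upwards [Metric.tendsto_nhds.1 (H j) (ε / 3) (by positivity)] with i hi
  have h1 := (hg i).dist_le_mul (w j) v
  rw [NNReal.coe_one, one_mul] at h1
  have h2 := dist_triangle4 (g i v) (g i (w j)) (h (w j)) (h v)
  rw [dist_comm] at h1
  linarith

variable {I : Type*} {U : Ultrafilter I}

/-- In `ℓ_p` the norms of a fixed vector and of a coordinatewise null sequence add up in the limit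
as for disjointly supported vectors. -/
theorem tendsto_norm_add_of_tendsto_coord {p : ℝ≥0∞} [Fact (1 ≤ p)] (hp : p ≠ ∞)
    {z : I → lp (fun _ : ℕ => ℝ) p} (hz : ∀ n, Tendsto (fun i => z i n) U (𝓝 0)) {c : ℝ}
    (hc : Tendsto (fun i => ‖z i‖) U (𝓝 c)) (v : lp (fun _ : ℕ => ℝ) p) :
    Tendsto (fun i => ‖v + z i‖) U (𝓝 ((‖v‖ ^ p.toReal + c ^ p.toReal) ^ (1 / p.toReal))) := by
  have hp0 := toReal_pos_of_ne_top hp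
  refine tendsto_of_lipschitz_of_tendsto (g := fun i v => ‖v + z i‖)
    (h := fun v => (‖v‖ ^ p.toReal + c ^ p.toReal) ^ (1 / p.toReal)) (fun i => ?_)
    (lp.hasSum_single hp v) ?_ fun S => ?_
  · refine LipschitzWith.of_dist_le_mul fun v w => ?_
    rw [Real.dist_eq, dist_eq_norm, NNReal.coe_one, one_mul]
    refine (abs_norm_sub_norm_le _ _).trans ?_
    rw [add_sub_add_right_eq_sub]
  · exact ((((lp.hasSum_single hp v).norm.rpow_const (Or.inr hp0.le)).add_const _).rpow_const
      (Or.inr (by positivity)))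
  · set w := ∑ i ∈ S, lp.single p i (v i) with hw
    have hwS : ∀ n, n ∉ S → w n = 0 := fun n hn => sum_single_apply_of_notMem v hn
    have h1 : Tendsto (fun i => ‖w + z i‖ ^ p.toReal) U (𝓝 (‖w‖ ^ p.toReal + c ^ p.toReal)) := by
      have e0 : ‖w‖ ^ p.toReal = ∑ n ∈ S, ‖w n + 0‖ ^ p.toReal := by
        have := norm_add_rpow_of_support hp hwS 0
        simpa [Real.zero_rpow hp0.ne'] using this
      have h2 : Tendsto (fun i => ∑ n ∈ S, ‖w n + z i n‖ ^ p.toReal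
          + (‖z i‖ ^ p.toReal - ∑ n ∈ S, ‖z i n‖ ^ p.toReal)) U
          (𝓝 (∑ n ∈ S, ‖w n + 0‖ ^ p.toReal
            + (c ^ p.toReal - ∑ n ∈ S, ‖(0 : ℝ)‖ ^ p.toReal))) :=
        (tendsto_finsetSum _ fun n _ =>
          (((hz n).const_add (w n)).norm.rpow_const (Or.inr hp0.le))).add
          ((hc.rpow_const (Or.inr hp0.le)).sub
            (tendsto_finsetSum _ fun n _ => ((hz n).norm.rpow_const (Or.inr hp0.le))))
      rw [← e0] at h2
      simp only [norm_zero, Real.zero_rpow hp0.ne', Finset.sum_const_zero, sub_zero] at h2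
      exact h2.congr fun i => (norm_add_rpow_of_support hp hwS (z i)).symm
    have h3 := h1.rpow_const (p := 1 / p.toReal) (Or.inr (by positivity))
    refine h3.congr fun i => ?_
    rw [one_div, Real.rpow_rpow_inv (norm_nonneg _) hp0.ne']

theorem tendsto_norm_add_sum_of_tendsto_coord {p : ℝ≥0∞} [Fact (1 ≤ p)] (hp : p ≠ ∞)
    {z : I → lp (fun _ : ℕ => ℝ) p} (hz : ∀ n, Tendsto (fun i => z i n) U (𝓝 0)) {c : ℝ}
    (hc : Tendsto (fun i => ‖z i‖) U (𝓝 c)) {n : ℕ} (a : Fin n → ℝ)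
    (v : lp (fun _ : ℕ => ℝ) p) :
    Tendsto (fun k : Fin n → I => ‖v + ∑ j, a j • z (k j)‖) (iterPow U n)
      (𝓝 ((‖v‖ ^ p.toReal + c ^ p.toReal * ∑ j, |a j| ^ p.toReal) ^ (1 / p.toReal))) := by
  have hp0 := toReal_pos_of_ne_top hp
  have hc0 : 0 ≤ c := ge_of_tendsto hc (Eventually.of_forall fun i => norm_nonneg _)
  induction n generalizing v with
  | zero =>
    simp only [Finset.univ_eq_empty, Finset.sum_empty, mul_zero, add_zero]
    rw [one_div, Real.rpow_rpow_inv (norm_nonneg _) hp0.ne']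
    exact tendsto_const_nhds
  | succ n ih =>
    refine tendsto_iterPow_succ (g := fun i => (‖v + a 0 • z i‖ ^ p.toReal
      + c ^ p.toReal * ∑ j : Fin n, |a j.succ| ^ p.toReal) ^ (1 / p.toReal)) (fun i => ?_) ?_
    · simpa [Fin.sum_univ_succ, add_assoc] using ih (fun j => a j.succ) (v + a 0 • z i)
    · have h1 := tendsto_norm_add_of_tendsto_coord (U := U) hp (z := fun i => a 0 • z i)
        (c := |a 0| * c) (fun n => by simpa using (hz n).const_mul (a 0))
        (by simpa [norm_smul] using hc.const_mul |a 0|) v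
      have h2 := ((h1.rpow_const (p := p.toReal) (Or.inr hp0.le)).add_const
        (c ^ p.toReal * ∑ j : Fin n, |a j.succ| ^ p.toReal)).rpow_const (p := 1 / p.toReal)
        (Or.inr (by positivity))
      convert h2 using 3
      rw [one_div, Real.rpow_inv_rpow (by positivity) hp0.ne', Fin.sum_univ_succ,
        Real.mul_rpow (abs_nonneg _) hc0]
      ring

end limits

/-! ### Norms of `ℓ_r` on finite sequences -/

section ell

/-- The `ℓ_r` norm on finite sequences. -/
noncomputable def ellNorm (r : ℝ) {n : ℕ} (a : Fin n → ℝ) : ℝ := (∑ j, |a j| ^ r) ^ (1 / r)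

theorem ellNorm_nonneg (r : ℝ) {n : ℕ} (a : Fin n → ℝ) : 0 ≤ ellNorm r a := by
  unfold ellNorm
  positivity

/-- With `A` the `ℓ_r` norm, every `|a j| ≤ A`, so `|a j| ^ s ≤ A ^ (s - r) * |a j| ^ r`, and these
bounds are summed. -/
theorem ellNorm_anti {r s : ℝ} (hr : 0 < r) (hrs : r ≤ s) {n : ℕ} (a : Fin n → ℝ) :
    ellNorm s a ≤ ellNorm r a := by
  have hs := hr.trans_le hrs
  set A := ellNorm r a with hA
  have hA0 : 0 ≤ A := ellNorm_nonneg r a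
  have hAr : ∑ j, |a j| ^ r = A ^ r := by
    rw [hA, ellNorm, one_div, Real.rpow_inv_rpow (by positivity) hr.ne']
  have h1 : ∀ j, |a j| ≤ A := fun j => by
    rw [← Real.rpow_le_rpow_iff (abs_nonneg _) hA0 hr, ← hAr]
    exact Finset.single_le_sum (f := fun j => |a j| ^ r) (fun _ _ => by positivity)
      (Finset.mem_univ j)
  have h2 : ∑ j, |a j| ^ s ≤ A ^ s := by
    have e : A ^ s = A ^ (s - r) * ∑ j, |a j| ^ r := by
      rw [hAr, ← Real.rpow_add_of_nonneg hA0 (by linarith) hr.le, sub_add_cancel]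
    rw [e, Finset.mul_sum]
    refine Finset.sum_le_sum fun j _ => ?_
    have e2 : |a j| ^ s = |a j| ^ (s - r) * |a j| ^ r := by
      rw [← Real.rpow_add_of_nonneg (abs_nonneg _) (by linarith) hr.le, sub_add_cancel]
    rw [e2]
    have := h1 j
    have : 0 ≤ s - r := by linarith
    gcongr
  calc ellNorm s a = (∑ j, |a j| ^ s) ^ (1 / s) := rfl
    _ ≤ (A ^ s) ^ (1 / s) := by gcongr
    _ = A := by rw [one_div, Real.rpow_rpow_inv hA0 hs.ne']

theorem ellNorm_two_sq {n : ℕ} (a : Fin n → ℝ) : ellNorm 2 a ^ 2 = ∑ j, a j ^ 2 := by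
  rw [ellNorm, ← Real.rpow_natCast, ← Real.rpow_mul (by positivity)]
  norm_num

theorem ellNorm_one {r : ℝ} {n : ℕ} : ellNorm r (fun _ : Fin n => (1 : ℝ)) = (n : ℝ) ^ (1 / r) := by
  simp [ellNorm]

theorem rpow_add_rpow_sq_le {r A B : ℝ} (hr : 2 ≤ r) (hA : 0 ≤ A) (hB : 0 ≤ B) :
    ((A ^ r + B ^ r) ^ (1 / r)) ^ 2 ≤ A ^ 2 + B ^ 2 := by
  have h1 := ellNorm_anti (r := 2) two_pos hr ![A, B]
  have h2 := ellNorm_two_sq ![A, B]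
  simp only [Fin.sum_univ_two, Matrix.cons_val_zero, Matrix.cons_val_one] at h2
  rw [← h2]
  have e : (A ^ r + B ^ r) ^ (1 / r) = ellNorm r ![A, B] := by
    simp [ellNorm, abs_of_nonneg hA, abs_of_nonneg hB]
  rw [e]
  exact pow_le_pow_left₀ (ellNorm_nonneg _ _) h1 2

end ell

/-! ### The spreading models of an `ℓ₂`-sum of `ℓ_p` spaces -/

section EllTwoSum

variable {ι : Type*} {p : ι → Set.Icc (2 : ℝ) 3}

theorem toReal_ofReal_exponent (q : Set.Icc (2 : ℝ) 3) :
    (ENNReal.ofReal (q : ℝ)).toReal = q :=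
  ENNReal.toReal_ofReal (zero_le_two.trans q.2.1)

theorem exponent_pos (q : Set.Icc (2 : ℝ) 3) : (0 : ℝ) < q := two_pos.trans_le q.2.1

theorem one_lt_ofReal_exponent (q : Set.Icc (2 : ℝ) 3) : 1 < ENNReal.ofReal (q : ℝ) :=
  ENNReal.one_lt_ofReal.2 (one_lt_two.trans_le q.2.1)

theorem isReflexiveSpace_ellTwoSum : IsReflexiveSpace (EllTwoSum p) := by
  classical
  exact isReflexiveSpace_lp (by norm_num) (by norm_num) fun β =>
    isReflexiveSpace_lp (one_lt_ofReal_exponent _) ENNReal.ofReal_ne_top fun _ =>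
      isReflexiveSpace_real

theorem separableSpace_ellTwoSum [Countable ι] :
    TopologicalSpace.SeparableSpace (EllTwoSum p) := by
  classical
  have : ∀ β, TopologicalSpace.SeparableSpace
      (lp (fun _ : ℕ => ℝ) (ENNReal.ofReal (p β : ℝ))) := fun β =>
    separableSpace_lp ENNReal.ofReal_ne_top
  exact separableSpace_lp (by norm_num)

/-! ### The unit vector bases of the summands and their spreading models. -/

section unitVector

variable [DecidableEq ι]

/-- The `m`-th unit vector of the `β`-th summand. -/
noncomputable def unitVector (p : ι → Set.Icc (2 : ℝ) 3) (β : ι) (m : ℕ) : EllTwoSum p :=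
  lp.single 2 β (lp.single (ENNReal.ofReal (p β : ℝ)) m (1 : ℝ))

theorem norm_sum_unitVector (β : ι) {J : Type*} (s : Finset J) (a : J → ℝ) {k : J → ℕ}
    (hk : Set.InjOn k s) :
    ‖∑ j ∈ s, a j • unitVector p β (k j)‖ = (∑ j ∈ s, |a j| ^ (p β : ℝ)) ^ (1 / (p β : ℝ)) := by
  classical
  have hp0 := exponent_pos (p β)
  have e : ∑ j ∈ s, a j • unitVector p β (k j) = lp.single 2 β
      (∑ j ∈ s, a j • lp.single (ENNReal.ofReal (p β : ℝ)) (k j) (1 : ℝ) :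
        lp (fun _ : ℕ => ℝ) (ENNReal.ofReal (p β : ℝ))) := by
    have := map_sum (lp.lsingle (𝕜 := ℝ)
      (E := fun β : ι => lp (fun _ : ℕ => ℝ) (ENNReal.ofReal (p β : ℝ))) 2 β)
      (fun j => a j • lp.single (ENNReal.ofReal (p β : ℝ)) (k j) (1 : ℝ)) s
    simp only [map_smul] at this
    exact this.symm
  rw [e, lp.norm_single (by norm_num)]
  have key : ‖(∑ j ∈ s, a j • lp.single (ENNReal.ofReal (p β : ℝ)) (k j) (1 : ℝ) :
        lp (fun _ : ℕ => ℝ) (ENNReal.ofReal (p β : ℝ)))‖ ^ (p β : ℝ)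
      = ∑ j ∈ s, |a j| ^ (p β : ℝ) := by
    clear e
    induction s using Finset.induction_on with
    | empty => simp [Real.zero_rpow hp0.ne']
    | insert j s hj ih =>
      rw [Finset.sum_insert hj, Finset.sum_insert hj]
      have h1 := norm_add_rpow_of_disjoint (p := ENNReal.ofReal (p β : ℝ)) ENNReal.ofReal_ne_top
        (v := a j • lp.single (E := fun _ : ℕ => ℝ) (ENNReal.ofReal (p β : ℝ)) (k j) (1 : ℝ))
        (w := ∑ j ∈ s, a j • lp.single (ENNReal.ofReal (p β : ℝ)) (k j) (1 : ℝ)) (fun i => by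
          by_cases hi : i = k j
          · right
            rw [lp.coeFn_sum, Finset.sum_apply]
            refine Finset.sum_eq_zero fun l hl => ?_
            have hne : k l ≠ k j := fun h => hj (by
              rwa [← hk (Finset.mem_insert_of_mem hl) (Finset.mem_insert_self j s) h])
            simp [hi, hne.symm]
          · left
            simp [hi])
      rw [toReal_ofReal_exponent] at h1
      rw [h1, ih (hk.mono (by simp)), norm_smul,
        lp.norm_single (by simpa using hp0), norm_one, mul_one,
        Real.norm_eq_abs]
  rw [← key, one_div, Real.rpow_rpow_inv (norm_nonneg _) hp0.ne']

theorem norm_unitVector (β : ι) (m : ℕ) : ‖unitVector p β m‖ = 1 := by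
  rw [unitVector, lp.norm_single (by norm_num), lp.norm_single (by simpa using exponent_pos (p β)),
    norm_one]

theorem norm_partial_sum_unitVector_le (β : ι) (b : ℕ → ℝ) (m n : ℕ) (hmn : m ≤ n) :
    ‖∑ i ∈ Finset.range m, b i • unitVector p β i‖
      ≤ 1 * ‖∑ i ∈ Finset.range n, b i • unitVector p β i‖ := by
  have hp0 := exponent_pos (p β)
  have h := fun n => norm_sum_unitVector (p := p) β (Finset.range n) b (k := fun i => i)
    (Set.injOn_id _)
  rw [one_mul, h, h]
  refine Real.rpow_le_rpow (by positivity) ?_ (by positivity)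
  exact Finset.sum_le_sum_of_subset_of_nonneg (Finset.range_mono hmn) fun _ _ _ => by positivity

theorem unitVector_ne_zero (β : ι) (m : ℕ) : unitVector p β m ≠ 0 :=
  norm_ne_zero_iff.1 (by rw [norm_unitVector]; exact one_ne_zero)

theorem not_finiteDimensional_ellTwoSum [Nonempty ι] : ¬ FiniteDimensional ℝ (EllTwoSum p) := by
  intro h
  obtain ⟨β⟩ := ‹Nonempty ι›
  have h1 : LinearIndependent ℝ (unitVector p β) := linearIndependent_of_norm_partial_sum_le
    (unitVector_ne_zero β) (norm_partial_sum_unitVector_le β)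
  exact not_finite_iff_infinite.2 (inferInstance : Infinite ℕ) h1.finite

theorem isWeaklyNull_unitVector (β : ι) : IsWeaklyNull (unitVector p β) := by
  intro f
  rw [Metric.tendsto_atTop]
  intro ε hε
  obtain ⟨S, hS⟩ := exists_finset_abs_le (one_lt_ofReal_exponent (p β)) ENNReal.ofReal_ne_top
    (f.comp (lp.singleContinuousLinearMap ℝ
      (fun β : ι => lp (fun _ : ℕ => ℝ) (ENNReal.ofReal (p β : ℝ))) 2 β)) (half_pos hε)
  obtain ⟨n, hn⟩ := S.exists_nat_subset_range
  refine ⟨n, fun m hm => ?_⟩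
  have h1 := hS (lp.single (ENNReal.ofReal (p β : ℝ)) m (1 : ℝ)) fun i hi => by
    have hne : i ≠ m := by
      have := Finset.mem_range.1 (hn hi)
      omega
    simp [hne]
  rw [lp.norm_single (by simpa using exponent_pos (p β)), norm_one, mul_one] at h1
  rw [Real.dist_eq, sub_zero]
  exact lt_of_le_of_lt h1 (half_lt_self hε)

/-- The spreading model of the unit vector basis of the `β`-th summand. -/
noncomputable def unitVectorModel (p : ι → Set.Icc (2 : ℝ) 3) (β : ι) :
    WeakSpreadingModel (EllTwoSum p) := by
  refine ⟨(normSeminorm ℝ (EllTwoSum p)).comp (Finsupp.linearCombination ℝ (unitVector p β)),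
    unitVector p β, isWeaklyNull_unitVector β, norm_unitVector β,
    isBasicSequence_of_norm_partial_sum_le (unitVector_ne_zero β)
      (norm_partial_sum_unitVector_le β), fun _ => 0, antitone_const, tendsto_const_nhds,
    fun n a _ k hk _ => ?_⟩
  have h1 := norm_sum_unitVector (p := p) β Finset.univ a hk.injective.injOn
  have h2 := norm_sum_unitVector (p := p) β Finset.univ a (k := fun i : Fin n => (i : ℕ))
    Fin.val_injective.injOn
  simp [map_sum, h1, h2]

theorem unitVectorModel_apply (β : ι) {n : ℕ} (a : Fin n → ℝ) :
    (unitVectorModel p β).1 (∑ i : Fin n, Finsupp.single (i : ℕ) (a i)) = ellNorm (p β) a := by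
  have h2 := norm_sum_unitVector (p := p) β Finset.univ a (k := fun i : Fin n => (i : ℕ))
    Fin.val_injective.injOn
  simpa [unitVectorModel, map_sum, ellNorm] using h2

/-- On the all-ones vector of length `n`, domination reads `n ^ (1 / p β) ≤ C * n ^ (1 / p γ)`,
which for all `n` forces `p γ ≤ p β`. -/
theorem unitVectorModel_le_iff (β γ : ι) :
    unitVectorModel p β ≤ unitVectorModel p γ ↔ p γ ≤ p β := by
  constructor
  · rintro ⟨C, hC⟩
    by_contra! hlt
    have hlt' : (p β : ℝ) < p γ := hlt
    have h1 : ∀ n : ℕ, (n : ℝ) ^ (1 / (p β : ℝ)) ≤ C * (n : ℝ) ^ (1 / (p γ : ℝ)) := fun n => by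
      have := hC (∑ i : Fin n, Finsupp.single (i : ℕ) 1)
      rwa [unitVectorModel_apply, unitVectorModel_apply, ellNorm_one, ellNorm_one] at this
    have hexp : 0 < 1 / (p β : ℝ) - 1 / (p γ : ℝ) :=
      sub_pos.2 (one_div_lt_one_div_of_lt (exponent_pos _) hlt')
    have htend : Tendsto (fun n : ℕ => (n : ℝ) ^ (1 / (p β : ℝ) - 1 / (p γ : ℝ))) atTop atTop :=
      (tendsto_rpow_atTop hexp).comp tendsto_natCast_atTop_atTop
    obtain ⟨n, hn, hn0⟩ := ((htend.eventually_gt_atTop C).and (eventually_gt_atTop 0)).exists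
    have hn0' : (0 : ℝ) < n := by exact_mod_cast hn0
    have h2 := h1 n
    have h3 : (0 : ℝ) < (n : ℝ) ^ (1 / (p γ : ℝ)) := Real.rpow_pos_of_pos hn0' _
    rw [Real.rpow_sub hn0', lt_div_iff₀ h3] at hn
    linarith
  · intro h
    refine ⟨1, fun f => ?_⟩
    obtain ⟨n, a, rfl⟩ := exists_eq_sum_single f
    rw [unitVectorModel_apply, unitVectorModel_apply, one_mul]
    exact ellNorm_anti (exponent_pos _) h a

end unitVector

/-! ### Iterated limits along weakly null sequences in terms of the coordinate masses `c β`. -/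

section weaklyNull

variable {I : Type*} {U : Ultrafilter I} {x : I → EllTwoSum p} {c : ι → ℝ}

theorem norm_add_sq_of_support {v : EllTwoSum p} {S : Finset ι} (hv : ∀ β, β ∉ S → v β = 0)
    (z : EllTwoSum p) :
    ‖v + z‖ ^ 2 = ∑ β ∈ S, ‖v β + z β‖ ^ 2 + (‖z‖ ^ 2 - ∑ β ∈ S, ‖z β‖ ^ 2) := by
  have := norm_add_rpow_of_support (p := 2) (by norm_num) hv z
  simpa only [ENNReal.toReal_ofNat, Real.rpow_two] using this

theorem tendsto_coord (hw : ∀ f : StrongDual ℝ (EllTwoSum p), Tendsto (fun i => f (x i)) U (𝓝 0))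
    (β : ι) (m : ℕ) : Tendsto (fun i => x i β m) U (𝓝 0) :=
  hw ((lp.evalCLM ℝ (fun _ : ℕ => ℝ) (ENNReal.ofReal (p β : ℝ)) m).comp (lp.evalCLM ℝ
    (fun β : ι => lp (fun _ : ℕ => ℝ) (ENNReal.ofReal (p β : ℝ))) 2 β))

/-- The contribution of the coordinate `β` to the norm of a combination of a weakly null
sequence. -/
theorem tendsto_norm_coord_sum
    (hw : ∀ f : StrongDual ℝ (EllTwoSum p), Tendsto (fun i => f (x i)) U (𝓝 0)) {β : ι}
    (hc : Tendsto (fun i => ‖x i β‖) U (𝓝 (c β))) {n : ℕ} (a : Fin n → ℝ) :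
    Tendsto (fun k : Fin n → I => ‖(∑ j, a j • x (k j)) β‖) (iterPow U n)
      (𝓝 (c β * ellNorm (p β) a)) := by
  have hp0 := exponent_pos (p β)
  have hc0 : 0 ≤ c β := ge_of_tendsto hc (Eventually.of_forall fun i => norm_nonneg _)
  have h1 := tendsto_norm_add_sum_of_tendsto_coord ENNReal.ofReal_ne_top (tendsto_coord hw β) hc a 0
  rw [toReal_ofReal_exponent, norm_zero, Real.zero_rpow hp0.ne', zero_add,
    Real.mul_rpow (by positivity) (by positivity), one_div, Real.rpow_rpow_inv hc0 hp0.ne',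
    ← one_div] at h1
  refine h1.congr fun k => ?_
  rw [zero_add, lp.coeFn_sum, Finset.sum_apply]
  rfl

/-- Here `d ^ 2` is a lower bound for the mass escaping every finite set of summands. If `v` is
supported in `S`, then `L ^ 2` is `∑ w β ^ 2 + a ^ 2 * (1 - ∑ c β ^ 2)` over `S`, where `w β` is the
`ℓ_{p β}` combination of `‖v β‖` and `|a| * c β`. It is at least `‖v β‖`, and at most the `ℓ₂`
combination because `p β ≥ 2`. Density gives all `v`. -/
theorem sq_tendsto_bounds (hx : ∀ i, ‖x i‖ = 1)
    (hw : ∀ f : StrongDual ℝ (EllTwoSum p), Tendsto (fun i => f (x i)) U (𝓝 0))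
    (hc : ∀ β, Tendsto (fun i => ‖x i β‖) U (𝓝 (c β))) {d : ℝ}
    (hd : ∀ S : Finset ι, ∑ β ∈ S, c β ^ 2 ≤ 1 - d ^ 2) (a : ℝ) (v : EllTwoSum p) {L : ℝ}
    (hL : Tendsto (fun i => ‖v + a • x i‖) U (𝓝 L)) :
    ‖v‖ ^ 2 + d ^ 2 * a ^ 2 ≤ L ^ 2 ∧ L ^ 2 ≤ ‖v‖ ^ 2 + a ^ 2 := by
  classical
  have hc0 : ∀ β, 0 ≤ c β := fun β =>
    ge_of_tendsto (hc β) (Eventually.of_forall fun i => norm_nonneg _)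
  have hbd : ∀ i, ‖a • x i‖ ≤ |a| := fun i => by simp [norm_smul, hx]
  choose G hG using fun w => exists_tendsto_lipschitz U lipschitzWith_one_norm hbd w
  have hGlip : ∀ v w, |G v - G w| ≤ ‖v - w‖ := fun v w =>
    le_of_tendsto ((hG v).sub (hG w)).abs (Eventually.of_forall fun i => by
      refine (abs_norm_sub_norm_le _ _).trans ?_
      rw [add_sub_add_right_eq_sub])
  have hsupp : ∀ (S : Finset ι) (v : EllTwoSum p), (∀ β, β ∉ S → v β = 0) →
      ‖v‖ ^ 2 + d ^ 2 * a ^ 2 ≤ G v ^ 2 ∧ G v ^ 2 ≤ ‖v‖ ^ 2 + a ^ 2 := by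
    intro S v hv
    let w : ι → ℝ := fun β =>
      (‖v β‖ ^ (p β : ℝ) + (|a| * c β) ^ (p β : ℝ)) ^ (1 / (p β : ℝ))
    have h1 : ∀ β, Tendsto (fun i => ‖v β + a • x i β‖) U (𝓝 (w β)) := fun β => by
      have := tendsto_norm_add_of_tendsto_coord (U := U) (p := ENNReal.ofReal (p β : ℝ))
        ENNReal.ofReal_ne_top (z := fun i => a • x i β)
        (fun m => by simpa using (tendsto_coord hw β m).const_mul a)
        (c := |a| * c β) (by simpa [norm_smul] using (hc β).const_mul |a|) (v β)
      rwa [toReal_ofReal_exponent] at this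
    have h2 : Tendsto (fun i => ∑ β ∈ S, ‖v β + a • x i β‖ ^ 2
        + (a ^ 2 - ∑ β ∈ S, (|a| * ‖x i β‖) ^ 2)) U
        (𝓝 (∑ β ∈ S, w β ^ 2 + (a ^ 2 - ∑ β ∈ S, (|a| * c β) ^ 2))) :=
      (tendsto_finsetSum _ fun β _ => (h1 β).pow 2).add ((tendsto_finsetSum _ fun β _ =>
        ((hc β).const_mul |a|).pow 2).const_sub _)
    have h3 : G v ^ 2 = ∑ β ∈ S, w β ^ 2 + (a ^ 2 - ∑ β ∈ S, (|a| * c β) ^ 2) := by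
      refine tendsto_nhds_unique ((hG v).pow 2) (h2.congr fun i => ?_)
      rw [norm_add_sq_of_support hv, norm_smul, hx, mul_one, Real.norm_eq_abs, sq_abs]
      simp only [lp.coeFn_smul, Pi.smul_apply, norm_smul, Real.norm_eq_abs]
    have h4 : ‖v‖ ^ 2 = ∑ β ∈ S, ‖v β‖ ^ 2 := by
      have := norm_add_sq_of_support hv 0
      simpa using this
    have h5 : ∑ β ∈ S, (|a| * c β) ^ 2 = a ^ 2 * ∑ β ∈ S, c β ^ 2 := by
      simp only [mul_pow, sq_abs, Finset.mul_sum]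
    have h6 : ∑ β ∈ S, w β ^ 2 ≤ ‖v‖ ^ 2 + ∑ β ∈ S, (|a| * c β) ^ 2 := by
      rw [h4, ← Finset.sum_add_distrib]
      exact Finset.sum_le_sum fun β _ => rpow_add_rpow_sq_le (p β).2.1 (norm_nonneg _)
        (mul_nonneg (abs_nonneg _) (hc0 β))
    have h7 : ‖v‖ ^ 2 ≤ ∑ β ∈ S, w β ^ 2 := by
      rw [h4]
      refine Finset.sum_le_sum fun β _ => pow_le_pow_left₀ (norm_nonneg _) ?_ 2
      have hp0 := exponent_pos (p β)
      have hcb := hc0 β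
      calc ‖v β‖ = (‖v β‖ ^ (p β : ℝ)) ^ (1 / (p β : ℝ)) := by
            rw [one_div, Real.rpow_rpow_inv (norm_nonneg _) hp0.ne']
        _ ≤ w β := by
            refine Real.rpow_le_rpow (by positivity) ?_ (by positivity)
            exact le_add_of_nonneg_right (by positivity)
    constructor
    · rw [h3, h5]
      nlinarith [hd S, sq_nonneg a]
    · rw [h3]
      linarith
  have hlim := lp.hasSum_single (p := 2) (by norm_num) v
  have hGv : Tendsto (fun S : Finset ι => G (∑ β ∈ S, lp.single 2 β (v β))) atTop (𝓝 (G v)) := by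
    rw [tendsto_iff_dist_tendsto_zero]
    refine squeeze_zero (fun _ => dist_nonneg) (fun S => ?_)
      (tendsto_iff_dist_tendsto_zero.1 hlim)
    rw [Real.dist_eq, dist_eq_norm]
    exact hGlip _ _
  rw [tendsto_nhds_unique hL (hG v)]
  have hb := fun S : Finset ι => hsupp S (∑ β ∈ S, lp.single 2 β (v β))
    fun β hβ => sum_single_apply_of_notMem v hβ
  exact ⟨le_of_tendsto_of_tendsto' ((hlim.norm.pow 2).add_const _) (hGv.pow 2) fun S => (hb S).1,
    le_of_tendsto_of_tendsto' (hGv.pow 2) ((hlim.norm.pow 2).add_const _) fun S => (hb S).2⟩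

theorem iterLim_sq_bounds (hx : ∀ i, ‖x i‖ = 1)
    (hw : ∀ f : StrongDual ℝ (EllTwoSum p), Tendsto (fun i => f (x i)) U (𝓝 0))
    (hc : ∀ β, Tendsto (fun i => ‖x i β‖) U (𝓝 (c β))) {d : ℝ}
    (hd : ∀ S : Finset ι, ∑ β ∈ S, c β ^ 2 ≤ 1 - d ^ 2) {n : ℕ} (a : Fin n → ℝ)
    (v : EllTwoSum p) :
    ‖v‖ ^ 2 + d ^ 2 * ∑ j, a j ^ 2 ≤ iterLim U norm (fun j i => a j • x i) v ^ 2 ∧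
      iterLim U norm (fun j i => a j • x i) v ^ 2 ≤ ‖v‖ ^ 2 + ∑ j, a j ^ 2 := by
  induction n generalizing v with
  | zero => simp [iterLim_zero]
  | succ n ih =>
    have h1 := (tendsto_iterLim_succ (U := U) lipschitzWith_one_norm
      (exists_bound_smul (fun i => (hx i).le) a) v).pow 2
    have hbd : ∀ i, ‖a 0 • x i‖ ≤ |a 0| := fun i => by simp [norm_smul, hx]
    obtain ⟨L, hL⟩ := exists_tendsto_lipschitz U lipschitzWith_one_norm hbd v
    obtain ⟨h2, h3⟩ := sq_tendsto_bounds hx hw hc hd (a 0) v hL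
    have h4 := le_of_tendsto_of_tendsto'
      ((hL.pow 2).add_const (d ^ 2 * ∑ j : Fin n, a j.succ ^ 2)) h1
      fun i => (ih (fun j => a j.succ) (v + a 0 • x i)).1
    have h5 := le_of_tendsto_of_tendsto' h1
      ((hL.pow 2).add_const (∑ j : Fin n, a j.succ ^ 2))
      fun i => (ih (fun j => a j.succ) (v + a 0 • x i)).2
    rw [Fin.sum_univ_succ, mul_add]
    constructor <;> linarith

/-- No mass escapes: up to a remainder of norm at most `d`, the sequence lives on finitely many
summands. Each contributes `c β * ellNorm (p β) a ≤ c β * ellNorm q a`, and the squares of the `c β`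
sum to at most `1`. Finally `d` tends to `0`. -/
theorem iterLim_le_ellNorm_of_sum_sq (hx : ∀ i, ‖x i‖ = 1)
    (hw : ∀ f : StrongDual ℝ (EllTwoSum p), Tendsto (fun i => f (x i)) U (𝓝 0))
    (hc : ∀ β, Tendsto (fun i => ‖x i β‖) U (𝓝 (c β)))
    (hS : ∀ d : ℝ, 0 < d → ∃ S : Finset ι, 1 - d ^ 2 < ∑ β ∈ S, c β ^ 2) {q : ℝ} (hq : 0 < q)
    (hcq : ∀ β, c β ≠ 0 → q ≤ p β) {n : ℕ} (a : Fin n → ℝ) :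
    iterLim U norm (fun j i => a j • x i) 0 ≤ ellNorm q a := by
  classical
  have hc0 : ∀ β, 0 ≤ c β := fun β =>
    ge_of_tendsto (hc β) (Eventually.of_forall fun i => norm_nonneg _)
  have hnorm := tendsto_iterLim_norm_zero (U := U) (exists_bound_smul (fun i => (hx i).le) a)
  have hsq : ∀ (w : EllTwoSum p) (S : Finset ι),
      ‖w - ∑ β ∈ S, lp.single 2 β (w β)‖ ^ 2 = ‖w‖ ^ 2 - ∑ β ∈ S, ‖w β‖ ^ 2 := fun w S => by
    have := lp.norm_compl_sum_single (p := 2) (by norm_num) w S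
    simpa only [ENNReal.toReal_ofNat, Real.rpow_two] using this
  have hc1 : ∀ S : Finset ι, ∑ β ∈ S, c β ^ 2 ≤ 1 := fun S =>
    le_of_tendsto' (tendsto_finsetSum S fun β _ => (hc β).pow 2) fun i => by
      have h1 := hsq (x i) S
      rw [hx] at h1
      nlinarith [sq_nonneg ‖x i - ∑ β ∈ S, lp.single 2 β (x i β)‖]
  have key : ∀ d : ℝ, 0 < d → iterLim U norm (fun j i => a j • x i) 0 ^ 2
      ≤ ellNorm q a ^ 2 + ((∑ j, |a j|) * d) ^ 2 := by
    intro d hd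
    obtain ⟨S, hSd⟩ := hS d hd
    let R : EllTwoSum p →ₗ[ℝ] EllTwoSum p := LinearMap.id - ∑ β ∈ S, (lp.lsingle (𝕜 := ℝ)
      (E := fun β : ι => lp (fun _ : ℕ => ℝ) (ENNReal.ofReal (p β : ℝ))) 2 β) ∘ₗ
        (lp.evalₗ (fun β : ι => lp (fun _ : ℕ => ℝ) (ENNReal.ofReal (p β : ℝ))) 2 β)
    have hR : ∀ w, R w = w - ∑ β ∈ S, lp.single 2 β (w β) := fun w => by
      simp [R]
    have hev : ∀ᶠ i in (U : Filter I), ‖R (x i)‖ ≤ d := by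
      have h1 : Tendsto (fun i => 1 - ∑ β ∈ S, ‖x i β‖ ^ 2) U (𝓝 (1 - ∑ β ∈ S, c β ^ 2)) :=
        (tendsto_finsetSum S fun β _ => (hc β).pow 2).const_sub 1
      filter_upwards [h1.eventually_lt_const (by linarith : 1 - ∑ β ∈ S, c β ^ 2 < d ^ 2)] with i hi
      refine (pow_le_pow_iff_left₀ (norm_nonneg _) hd.le two_ne_zero).1 ?_
      rw [hR, hsq, hx, one_pow]
      exact hi.le
    have h2 : Tendsto (fun k : Fin n → I => ∑ β ∈ S, ‖(∑ j, a j • x (k j)) β‖ ^ 2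
        + ((∑ j, |a j|) * d) ^ 2) (iterPow U n)
        (𝓝 (∑ β ∈ S, (c β * ellNorm (p β) a) ^ 2 + ((∑ j, |a j|) * d) ^ 2)) :=
      (tendsto_finsetSum S fun β _ => (tendsto_norm_coord_sum hw (hc β) a).pow 2).add_const _
    refine (le_of_tendsto_of_tendsto (hnorm.pow 2) h2 ?_).trans ?_
    · filter_upwards [eventually_all.2 fun j : Fin n => eventually_iterPow_eval j hev] with k hk
      have h3 := hsq (∑ j, a j • x (k j)) S
      rw [← hR, map_sum] at h3
      have h4 : ‖∑ j, R (a j • x (k j))‖ ≤ (∑ j, |a j|) * d := by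
        rw [Finset.sum_mul]
        refine norm_sum_le_of_le _ fun j _ => ?_
        rw [map_smul, norm_smul, Real.norm_eq_abs]
        exact mul_le_mul_of_nonneg_left (hk j) (abs_nonneg _)
      have h5 := pow_le_pow_left₀ (norm_nonneg _) h4 2
      linarith
    · gcongr
      calc ∑ β ∈ S, (c β * ellNorm (p β) a) ^ 2 ≤ ∑ β ∈ S, c β ^ 2 * ellNorm q a ^ 2 := by
            refine Finset.sum_le_sum fun β _ => ?_
            rw [mul_pow]
            by_cases hβ : c β = 0
            · simp [hβ]
            · have h6 := ellNorm_anti hq (hcq β hβ) a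
              have h7 := ellNorm_nonneg (p β) a
              gcongr
        _ ≤ ellNorm q a ^ 2 := by
            rw [← Finset.sum_mul]
            exact mul_le_of_le_one_left (sq_nonneg _) (hc1 S)
  have hlim : Tendsto (fun d : ℝ => ellNorm q a ^ 2 + ((∑ j, |a j|) * d) ^ 2) (𝓝[>] 0)
      (𝓝 (ellNorm q a ^ 2 + ((∑ j, |a j|) * 0) ^ 2)) :=
    (((continuous_const.mul continuous_id).pow 2).const_add _).tendsto _ |>.mono_left
      nhdsWithin_le_nhds
  have h8 := ge_of_tendsto hlim (eventually_mem_nhdsWithin.mono fun d hd => key d hd)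
  rw [mul_zero, zero_pow two_ne_zero, add_zero] at h8
  exact (le_abs_self _).trans (abs_le_of_sq_le_sq h8 (ellNorm_nonneg _ _))

end weaklyNull

/-! ### Classification of the spreading models: part (2). -/

section classification

variable [LinearOrder ι] [WellFoundedLT ι]

/-- Every weakly null spreading model is equivalent to the unit vector basis of a summand,
provided that `ℓ₂` is one of the summands. -/
theorem exists_equiv_unitVectorModel (hp : StrictMono p) {β₂ : ι} (hβ₂ : (p β₂ : ℝ) = 2)
    (M : WeakSpreadingModel (EllTwoSum p)) :
    ∃ β, M ≤ unitVectorModel p β ∧ unitVectorModel p β ≤ M := by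
  obtain ⟨N, x, hxw, hx⟩ := M
  let U := hyperfilter ℕ
  have hx1 : ∀ i, ‖x i‖ = 1 := hx.1
  have hw : ∀ f : StrongDual ℝ (EllTwoSum p), Tendsto (fun i => f (x i)) U (𝓝 0) := fun f =>
    (hxw f).mono_left Nat.hyperfilter_le_atTop
  have hN : ∀ {n : ℕ} (a : Fin n → ℝ), N (∑ i : Fin n, Finsupp.single (i : ℕ) (a i))
      = iterLim U norm (fun j i => a j • x i) 0 := fun a =>
    hx.eq_iterLim Nat.hyperfilter_le_atTop a
  have hNl : ∀ {n : ℕ} (a : Fin n → ℝ), Tendsto (fun k : Fin n → ℕ => ‖∑ j, a j • x (k j)‖)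
      (iterPow U n) (𝓝 (N (∑ i : Fin n, Finsupp.single (i : ℕ) (a i)))) := fun a =>
    hx.tendsto Nat.hyperfilter_le_atTop a
  choose c hc using fun β => exists_tendsto_of_bounded U (f := fun i => ‖x i β‖) (C := 1)
    fun i => by
      rw [abs_norm, ← hx1 i]
      exact lp.norm_apply_le_norm two_ne_zero (x i) β
  -- Either a positive amount of mass escapes and the model is squeezed between multiples of the
  -- `ℓ₂` norm, or the `c β ^ 2` sum to `1`.
  by_cases hd : ∃ d : ℝ, 0 < d ∧ ∀ S : Finset ι, ∑ β ∈ S, c β ^ 2 ≤ 1 - d ^ 2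
  · obtain ⟨d, hd0, hd⟩ := hd
    have hb : ∀ {n : ℕ} (a : Fin n → ℝ),
        (d * ellNorm 2 a) ^ 2 ≤ N (∑ i : Fin n, Finsupp.single (i : ℕ) (a i)) ^ 2 ∧
        N (∑ i : Fin n, Finsupp.single (i : ℕ) (a i)) ^ 2 ≤ ellNorm 2 a ^ 2 := fun a => by
      have := iterLim_sq_bounds hx1 hw hc hd a 0
      rw [mul_pow, ellNorm_two_sq, hN]
      simpa using this
    refine ⟨β₂, ⟨1, fun f => ?_⟩, ⟨d⁻¹, fun f => ?_⟩⟩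
    · obtain ⟨n, a, rfl⟩ := exists_eq_sum_single f
      rw [unitVectorModel_apply, one_mul, hβ₂]
      exact (le_abs_self _).trans (abs_le_of_sq_le_sq (hb a).2 (ellNorm_nonneg _ _))
    · obtain ⟨n, a, rfl⟩ := exists_eq_sum_single f
      rw [unitVectorModel_apply, hβ₂, inv_mul_eq_div, le_div_iff₀' hd0]
      exact (le_abs_self _).trans (abs_le_of_sq_le_sq (hb a).1 (apply_nonneg _ _))
  · push Not at hd
    have hne : ∃ β, c β ≠ 0 := by
      by_contra! h0
      obtain ⟨S, hS⟩ := hd 1 one_pos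
      simp [h0] at hS
    -- Among the summands carrying mass, the least index has the smallest exponent and hence the
    -- largest norm. It governs the upper bound, and its own coordinate gives the lower bound with
    -- constant `c β`.
    obtain ⟨β, hβ, hmin⟩ : ∃ β, c β ≠ 0 ∧ ∀ γ, c γ ≠ 0 → β ≤ γ :=
      ⟨wellFounded_lt.min {β | c β ≠ 0} hne, wellFounded_lt.min_mem _ hne,
        fun γ hγ => wellFounded_lt.min_le hγ⟩
    have hcβ : 0 < c β :=
      (ge_of_tendsto (hc β) (Eventually.of_forall fun i => norm_nonneg _)).lt_of_ne' hβ
    refine ⟨β, ⟨1, fun f => ?_⟩, ⟨(c β)⁻¹, fun f => ?_⟩⟩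
    · obtain ⟨n, a, rfl⟩ := exists_eq_sum_single f
      rw [unitVectorModel_apply, one_mul]
      refine (hN a).le.trans (iterLim_le_ellNorm_of_sum_sq hx1 hw hc hd (exponent_pos _)
        (fun γ hγ => hp.monotone (hmin γ hγ)) a)
    · obtain ⟨n, a, rfl⟩ := exists_eq_sum_single f
      rw [unitVectorModel_apply, inv_mul_eq_div, le_div_iff₀' hcβ]
      exact le_of_tendsto_of_tendsto' (tendsto_norm_coord_sum hw (hc β) a) (hNl a)
        fun k => lp.norm_apply_le_norm two_ne_zero _ β

theorem nonempty_orderIso_SPw_ellTwoSum (hp : StrictMono p) {β₂ : ι} (hβ₂ : (p β₂ : ℝ) = 2) :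
    Nonempty (SPw (EllTwoSum p) ≃o ιᵒᵈ) := by
  let f : ιᵒᵈ → SPw (EllTwoSum p) := fun β =>
    toAntisymmetrization (· ≤ ·) (unitVectorModel p (OrderDual.ofDual β))
  have hf : ∀ β γ : ιᵒᵈ, f β ≤ f γ ↔ β ≤ γ := fun β γ => by
    rw [toAntisymmetrization_le_toAntisymmetrization_iff, unitVectorModel_le_iff, hp.le_iff_le]
    rfl
  have hsurj : Function.Surjective f := fun s => by
    obtain ⟨β, h1, h2⟩ := exists_equiv_unitVectorModel hp hβ₂ (ofAntisymmetrization (· ≤ ·) s)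
    refine ⟨OrderDual.toDual β, ?_⟩
    rw [← toAntisymmetrization_ofAntisymmetrization (· ≤ ·) s]
    exact le_antisymm (toAntisymmetrization_le_toAntisymmetrization_iff.2 h2)
      (toAntisymmetrization_le_toAntisymmetrization_iff.2 h1)
  exact ⟨(RelIso.ofSurjective (OrderEmbedding.ofMapLEIff f hf) hsurj).symm⟩

/-- A countable well-ordered type embeds into `[2, 3]`, with its least element going to `2`. -/
theorem exists_strictMono_exponent [Countable ι] [Nonempty ι] :
    ∃ q : ι → Set.Icc (2 : ℝ) 3, StrictMono q ∧ ∃ β, (q β : ℝ) = 2 := by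
  classical
  obtain ⟨β₂, hβ₂⟩ : ∃ β₂ : ι, ∀ γ, β₂ ≤ γ :=
    ⟨wellFounded_lt.min Set.univ Set.univ_nonempty, fun γ => wellFounded_lt.min_le (Set.mem_univ γ)⟩
  have : Nontrivial (Set.Ioo (2 : ℝ) 3) :=
    ⟨⟨9 / 4, by norm_num⟩, ⟨5 / 2, by norm_num⟩, by norm_num [Subtype.ext_iff]⟩
  -- The open interval leaves the value `2` free for the least element.
  obtain ⟨e⟩ := Order.embedding_from_countable_to_dense ι (Set.Ioo (2 : ℝ) 3)
  refine ⟨fun β => if β = β₂ then ⟨2, by norm_num⟩ else ⟨e β, (e β).2.1.le, (e β).2.2.le⟩,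
    fun β γ hβγ => ?_, β₂, by simp⟩
  have hγ : γ ≠ β₂ := fun h => (h ▸ hβ₂ β).not_gt hβγ
  by_cases hβ : β = β₂
  · simp only [hβ, hγ, if_true, if_false]
    exact (e γ).2.1
  · simp only [hβ, hγ, if_false]
    exact e.lt_iff_lt.2 hβγ

end classification

end EllTwoSum

end SpreadingModels

theorem mainTheorem6 :
    (∀ (X : Type*) [NormedAddCommGroup X] [NormedSpace ℝ X] [CompleteSpace X],
      ¬ FiniteDimensional ℝ X →
      Countable (SPw X) →
      (∀ s t : SPw X, s ≤ t ∨ t ≤ s) →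
      ∃ α : Ordinal.{0}, α.card ≤ Cardinal.aleph0 ∧ Nonempty (SPw X ≃o (α.ToType)ᵒᵈ)) ∧
    (∀ α : Ordinal.{0}, 1 ≤ α → α.card ≤ Cardinal.aleph0 →
      ∃ p : α.ToType → Set.Icc (2 : ℝ) 3, StrictMono p ∧
        CompleteSpace (EllTwoSum p) ∧
        ¬ FiniteDimensional ℝ (EllTwoSum p) ∧
        TopologicalSpace.SeparableSpace (EllTwoSum p) ∧
        IsReflexiveSpace (EllTwoSum p) ∧
        Nonempty (SPw (EllTwoSum p) ≃o (α.ToType)ᵒᵈ)) := by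
  refine ⟨fun X _ _ _ _ hcount hchain => exists_ordinal_orderIso_SPw hchain, fun α hα1 hα => ?_⟩
  have hne : Nonempty α.ToType :=
    Ordinal.nonempty_toType_iff.2 (zero_lt_one.trans_le hα1).ne'
  have hcount : Countable α.ToType := by
    rwa [← Cardinal.mk_le_aleph0_iff, Cardinal.mk_toType]
  obtain ⟨p, hp, β, hβ⟩ := exists_strictMono_exponent (ι := α.ToType)
  exact ⟨p, hp, inferInstance, not_finiteDimensional_ellTwoSum, separableSpace_ellTwoSum,
    isReflexiveSpace_ellTwoSum, nonempty_orderIso_SPw_ellTwoSum hp hβ⟩
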